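/- **Setting.** There are $m\ge 2$ parties $P_1,\dots,P_m$ with private bit strings $x_1,\dots,x_m$. For each value $\kappa$ of the security parameter fix a finite field $\mathbb F=\mathbb F_\kappa$ with an injective binary encoding. Algorithms are probabilistic programs independent of $\kappa$; arithmetic and uniform sampling in $\mathbb F$ are elementary steps. Two ensembles indexed by $\kappa$ and by inputs $\mathbf x$ are *computationally indistinguishable* ($\overset{c}{\approx}$) if every polynomial-time probabilistic distinguisher with arbitrary advice, given $1^\kappa$, has an advantage that is at most a negligible function of $\kappa$, uniformly in all $\mathbf x$ of length bounded by a given polynomial in $\kappa$; they are *statistically indistinguishable* if their total variation distance $\Delta$ is negligible in the same sense. $[r]=(r_1,\dots,r_m)$ denotes an additive sharing of $r=\sum_i r_i$. **Functionalities.** For a predicate $Q$ of the inputs of a nonempty set $S$ of parties, $\mathcal F^Q_{\mathsf{PZS}}$ gives each party of $S$ a share; the shares are uniform subject to having sum $0$ if $Q(\mathbf x)=1$, and uniform without constraint if $Q(\mathbf x)=0$. A *relaxed* predicative zero-sharing $\mathcal F^Q_{\mathsf{rPZS}}$ is any probabilistic polynomial-time functionality which gives each party of $S$ a share and a hint (an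 additional datum), such that (correctness) the vector of shares is statistically indistinguishable from the output of $\mathcal F^Q_{\mathsf{PZS}}$, and (privacy) there is a probabilistic polynomial-time (PPT) simulator that for every proper subset $C\subsetneq S$, given $1^\kappa$, $C$, the inputs of $C$ and the shares that $\mathcal F^Q_{\mathsf{PZS}}$ gives to $C$, outputs a datum computationally indistinguishable from the shares and hints that $C$ receives. The secret need not be independent of these data. **Protocol.** Let $Q$ be a formula built with $\land$ and $\lor$ from literals $Q_1,\dots,Q_q$ ($q\ge 1$, one for each occurrence), each a predicate of the inputs of a nonempty set of parties, and let $|\mathsf{OR}|$ be the number of its $\lor$ operators. The protocol $\Pi^Q_{\mathsf{PZS}}$ runs as follows. 1. For each $i$ the parties involved in $Q_i$ call a relaxed predicative zero-sharing $\mathcal F^{Q_i}_{\mathsf{rPZS}}$; the other parties set their shares to $0$. 2. The parties evaluate $Q$ along the formula: for $\land$ they add the two sharings locally; for $\lor$ they multiply them with a fresh Beaver triple $([a],[b],[c])$, where $[a],[b]$ are uniform and $[c]$ is a uniform sharing of $ab$. From $[r],[r']$ they open $d=r-a$ and $e=r'-b$, and take shares of $c+db+ea+de$. Let $[r]$ be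 the final sharing. 3. With one more Beaver triple they open $u=r+a$ and output the shares of $[s]=u[b]-[c]$, a sharing of $r\cdot b$. To open a value, all parties send their shares to $P_1$, who sends the sum to all other parties. Beaver triples come from a trusted offline phase. **Theorem.** Let $\sigma=\sigma(\kappa)$ be such that $2^{-\sigma(\kappa)}$ is negligible, and let $|\mathbb F_\kappa|\ge 2^{\sigma(\kappa)}$ and $|\mathbb F_\kappa|\ge|\mathsf{OR}|\cdot 2^{\sigma(\kappa)}$ for all $\kappa$. Then $\Pi^Q_{\mathsf{PZS}}$ securely realizes $\mathcal F^Q_{\mathsf{PZS}}$ against semi-honest adversaries corrupting any $t<m$ parties in the $(\mathcal F^{Q_1}_{\mathsf{rPZS}},\dots,\mathcal F^{Q_q}_{\mathsf{rPZS}})$-hybrid model: there is a PPT simulator $\mathsf{Sim}$ such that for every proper subset $\mathcal A$ of the parties $$\{\mathsf{Sim}(1^\kappa,\mathcal A,\mathbf x_{\mathcal A},\mathbf s_{\mathcal A}),\,\mathbf s\}_{\mathbf x}\ \overset{c}{\approx}\ \{\mathsf{View}^{\Pi}_{\mathcal A}(\mathbf x),\,\mathsf{Output}^{\Pi}(\mathbf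 x)\}_{\mathbf x},\qquad \mathbf s\gets\mathcal F^Q_{\mathsf{PZS}}(\mathbf x),$$ where the view of a party consists of its input and everything it samples or receives. (Running times of simulators are polynomial in $\kappa$ and the length of the inputs they are given.) Moreover the protocol is correct in the following quantitative sense. For every $\kappa$ and $\mathbf x$, let $\varepsilon_i$ be the total variation distance between the share vector of the $i$-th call in step 1 and the output of $\mathcal F^{Q_i}_{\mathsf{PZS}}$. Let $f(\mathbf x)$ be $0$ if $Q(\mathbf x)=1$ and uniform in $\mathbb F$ otherwise. Then the secret $r$ at the end of step 2 and the output of the protocol satisfy $$\Delta\bigl(r,\,f(\mathbf x)\bigr)\le\sum_{i=1}^q\varepsilon_i+2^{-\sigma},\qquad \Delta\bigl(\mathsf{Output}^{\Pi}(\mathbf x),\,\mathcal F^Q_{\mathsf{PZS}}(\mathbf x)\bigr)\le\sum_{i=1}^q\varepsilon_i+2\cdot2^{-\sigma}.$$ -/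

import Mathlib

namespace PZS

/-! ### Data, programs and running time -/

/-- Data handled by programs at a fixed value of the security parameter: binary trees whose leaves
are empty or carry an element of the field `F`. -/
inductive Val (F : Type) : Type
  | nil : Val F
  | elt (x : F) : Val F
  | pair (a b : Val F) : Val F

namespace Val

variable {F : Type}

/-- The Boolean `true`; the Boolean `false` is `nil`. -/
def tt : Val F := pair nil nil

def ofBool : Bool → Val F
  | false => nil
  | true => tt

def ofList : List (Val F) → Val F
  | [] => nil
  | a :: l => pair a (ofList l)

def ofBits (l : List Bool) : Val F := ofList (l.map ofBool)

def ofOption : Option (Val F) → Val F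
  | none => nil
  | some a => pair a nil

/-- The string `1ⁿ`. -/
def unary (n : ℕ) : Val F := ofList (List.replicate n nil)

/-- The length of a list; trees that are not built by `ofList` are read as lists along their right
spine. -/
def len : Val F → ℕ
  | pair _ b => len b + 1
  | _ => 0

def head : Val F → Val F
  | pair a _ => a
  | _ => nil

def tail : Val F → Val F
  | pair _ b => b
  | _ => nil

/-- A field operation on two elements (`nil` on data of another shape). -/
def binop (f : F → F → F) : Val F → Val F
  | pair (elt x) (elt y) => elt (f x y)
  | _ => nil

def unop (f : F → F) : Val F → Val F
  | elt x => elt (f x)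
  | _ => nil

/-- The binary representation of a field element. -/
def toBits (enc : F ↪ List Bool) : Val F → Val F
  | elt x => ofBits (enc x)
  | _ => nil

open Classical in
/-- The field element with a given binary representation (`nil` if there is none). -/
noncomputable def fromBits (enc : F ↪ List Bool) (v : Val F) : Val F :=
  if h : ∃ x, ofBits (enc x) = v then elt h.choose else nil

end Val

/-- Probabilistic programs. A program maps a datum to a random datum and takes a number of steps. It
does not depend on the security parameter nor on the field. -/
inductive Prog : Type
  | skip : Prog
  | nil : Prog
  | head : Prog
  | tail : Prog
  | pair (p q : Prog) : Prog
  /-- first `p`, then `q` -/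
  | seq (p q : Prog) : Prog
  /-- on `(c, w)`: run `q` on `w` if `c = nil`, and `p` on `w` otherwise -/
  | cond (p q : Prog) : Prog
  /-- on `(n, w)`: apply `p` to `w`, as many times as the list `n` is long -/
  | loop (p : Prog) : Prog
  /-- a uniformly random bit -/
  | coin : Prog
  /-- a uniformly random field element -/
  | unif : Prog
  | one : Prog
  | add : Prog
  | mul : Prog
  | neg : Prog
  | inv : Prog
  | toBits : Prog
  | fromBits : Prog

section Semantics

variable {F : Type} [Field F] [Fintype F]

/-- Iterate a randomized step that reports its cost. -/
noncomputable def iterate (f : Val F → PMF (Val F × ℕ)) : ℕ → Val F → PMF (Val F × ℕ)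
  | 0, v => PMF.pure (v, 1)
  | n + 1, v => (f v).bind fun r => (iterate f n r.1).map fun r' => (r'.1, r.2 + r'.2 + 1)

/-- The joint law of the result and of the number of steps of a program. Elementary operations,
among them arithmetic and uniform sampling in `F`, take one step; conversions between field elements
and bit strings take as many steps as the string is long, plus one. -/
noncomputable def Prog.exec (enc : F ↪ List Bool) : Prog → Val F → PMF (Val F × ℕ)
  | .skip, v => PMF.pure (v, 1)
  | .nil, _ => PMF.pure (Val.nil, 1)
  | .head, v => PMF.pure (v.head, 1)
  | .tail, v => PMF.pure (v.tail, 1)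
  | .pair p q, v =>
      (p.exec enc v).bind fun r =>
        (q.exec enc v).map fun r' => (Val.pair r.1 r'.1, r.2 + r'.2 + 1)
  | .seq p q, v =>
      (p.exec enc v).bind fun r => (q.exec enc r.1).map fun r' => (r'.1, r.2 + r'.2 + 1)
  | .cond p q, v =>
      match v with
      | .pair .nil w => (q.exec enc w).map fun r => (r.1, r.2 + 1)
      | .pair _ w => (p.exec enc w).map fun r => (r.1, r.2 + 1)
      | _ => PMF.pure (Val.nil, 1)
  | .loop p, v => iterate (fun w => p.exec enc w) v.head.len v.tail
  | .coin, _ => (PMF.uniformOfFintype Bool).map fun b => (Val.ofBool b, 1)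
  | .unif, _ => (PMF.uniformOfFintype F).map fun x => (Val.elt x, 1)
  | .one, _ => PMF.pure (Val.elt 1, 1)
  | .add, v => PMF.pure (v.binop (· + ·), 1)
  | .mul, v => PMF.pure (v.binop (· * ·), 1)
  | .neg, v => PMF.pure (v.unop (- ·), 1)
  | .inv, v => PMF.pure (v.unop (·⁻¹), 1)
  | .toBits, v => PMF.pure (v.toBits enc, (v.toBits enc).len + 1)
  | .fromBits, v => PMF.pure (v.fromBits enc, v.len + 1)

/-- The law of the result of a program. -/
noncomputable def Prog.run (enc : F ↪ List Bool) (p : Prog) (v : Val F) : PMF (Val F) :=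
  (p.exec enc v).map Prod.fst

/-- On input `v`, the program `p` always halts within `T` steps. -/
def Prog.CostLE (enc : F ↪ List Bool) (p : Prog) (v : Val F) (T : ℕ) : Prop :=
  ∀ r ∈ (p.exec enc v).support, r.2 ≤ T

/-- The probability that a program answers `true`. -/
noncomputable def Prog.accept (enc : F ↪ List Bool) (p : Prog) (X : PMF (Val F)) : ℝ :=
  ((X.bind (p.run enc)) Val.tt).toReal

end Semantics

/-! ### Indistinguishability -/

/-- `μ` vanishes faster than every inverse polynomial. -/
def Negligible (μ : ℕ → ℝ) : Prop :=
  Asymptotics.SuperpolynomialDecay Filter.atTop (fun n : ℕ => (n : ℝ)) μ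

/-- Private inputs are bit strings. -/
abbrev Input : Type := List Bool

/-- The total length of the inputs of a set of parties. -/
def inputSize {P : Type} (C : Finset P) (x : P → Input) : ℕ := ∑ i ∈ C, (x i).length

/-- The statistical (total variation) distance. -/
noncomputable def tvDist {α : Type} [Fintype α] (p q : PMF α) : ℝ :=
  (∑ a, |(p a).toReal - (q a).toReal|) / 2

section Ensembles

variable {P : Type} [Fintype P] {F : ℕ → Type} [∀ κ, Field (F κ)] [∀ κ, Fintype (F κ)]

/-- Statistical indistinguishability of two ensembles that are indexed by the security parameter and
by the parties' inputs (of polynomial length). -/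
def StatIndist {α : ℕ → Type} [∀ κ, Fintype (α κ)]
    (X Y : (κ : ℕ) → (P → Input) → PMF (α κ)) : Prop :=
  ∀ L : Polynomial ℕ, ∃ μ : ℕ → ℝ, Negligible μ ∧
    ∀ κ x, inputSize Finset.univ x ≤ L.eval κ → tvDist (X κ x) (Y κ x) ≤ μ κ

/-- Computational indistinguishability against probabilistic distinguishers `D` with an arbitrary
advice `z`, which get `(1^κ, z, sample)` and halt within polynomially many steps. -/
def CompIndist (enc : ∀ κ, F κ ↪ List Bool)
    (X Y : (κ : ℕ) → (P → Input) → PMF (Val (F κ))) : Prop :=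
  ∀ (D : Prog) (T L : Polynomial ℕ), ∃ μ : ℕ → ℝ, Negligible μ ∧
    ∀ κ x, inputSize Finset.univ x ≤ L.eval κ → ∀ z : Val (F κ),
      (∀ v, D.CostLE (enc κ) (.pair (.unary κ) (.pair z v)) (T.eval κ)) →
      |D.accept (enc κ) ((X κ x).map fun v => .pair (.unary κ) (.pair z v)) -
        D.accept (enc κ) ((Y κ x).map fun v => .pair (.unary κ) (.pair z v))| ≤ μ κ

end Ensembles

/-! ### Predicative zero-sharing -/

section Functionality

variable {P : Type} [Fintype P] {F : Type} [Field F] [Fintype F]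

open Classical in
theorem sharings_nonempty [Nonempty P] (v : F) :
    (Finset.univ.filter fun s : P → F => ∑ i, s i = v).Nonempty := by
  obtain ⟨j⟩ := ‹Nonempty P›
  exact ⟨Pi.single j v, by simp⟩

open Classical in
/-- A uniformly random additive sharing of `v` among the parties `P`. -/
noncomputable def uniformSharing [Nonempty P] (v : F) : PMF (P → F) :=
  PMF.uniformOfFinset (Finset.univ.filter fun s : P → F => ∑ i, s i = v) (sharings_nonempty v)

open Classical in
/-- The ideal functionality for predicative zero-sharing: uniformly random shares, subject to having
sum zero if the predicate (of the inputs) holds. -/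
noncomputable def idealPZS [Nonempty P] (Q : Prop) : PMF (P → F) :=
  if Q then uniformSharing 0 else PMF.uniformOfFintype (P → F)

open Classical in
/-- The law of the secret that an ideal predicative zero-sharing distributes. -/
noncomputable def idealSecret (Q : Prop) : PMF F :=
  if Q then PMF.pure 0 else PMF.uniformOfFintype F

end Functionality

/-- The data of the parties in `C`, listed in the order of the parties. The entries of the other
parties are left blank. -/
def restrictTo {P F : Type} [Fintype P] [LinearOrder P] (C : Finset P) (w : P → Val F) : Val F :=
  Val.ofList <| ((Finset.univ : Finset P).sort (· ≤ ·)).map fun i =>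
    Val.ofOption (if i ∈ C then some (w i) else none)

/-- The list of all shares. -/
def sharesVal {P F : Type} [Fintype P] [LinearOrder P] (s : P → F) : Val F :=
  restrictTo Finset.univ fun i => Val.elt (s i)

section Security

variable {P : Type} [Fintype P] [LinearOrder P] {F : ℕ → Type}
  [∀ κ, Field (F κ)] [∀ κ, Fintype (F κ)]

/-- The input `(1^κ, C, x_C, s_C)` of a simulator: the security parameter, the set of corrupted
parties, their inputs and their shares. -/
def simInput (κ : ℕ) (C : Finset P) (x : P → Input) (s : P → F κ) : Val (F κ) :=
  .pair (.unary κ) (restrictTo C fun i => .pair (.ofBits (x i)) (.elt (s i)))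

/-- The simulator runs in probabilistic polynomial time. -/
def PolyTimeSim (enc : ∀ κ, F κ ↪ List Bool) (Sim : Prog) : Prop :=
  ∃ T : Polynomial ℕ, ∀ κ (C : Finset P) (x : P → Input) (s : P → F κ),
    Sim.CostLE (enc κ) (simInput κ C x s) (T.eval (κ + inputSize C x))

/-- `G`, which gives each party a share and an additional piece of information (a hint), is a
probabilistic polynomial-time functionality. -/
def PolyTimeFunctionality (enc : ∀ κ, F κ ↪ List Bool)
    (G : (κ : ℕ) → (P → Input) → PMF (P → F κ × Val (F κ))) : Prop :=
  ∃ (g : Prog) (T : Polynomial ℕ), ∀ κ (x : P → Input),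
    g.CostLE (enc κ) (.pair (.unary κ) (restrictTo Finset.univ fun i => .ofBits (x i)))
        (T.eval (κ + inputSize Finset.univ x)) ∧
      g.run (enc κ) (.pair (.unary κ) (restrictTo Finset.univ fun i => .ofBits (x i))) =
        (G κ x).map fun o => restrictTo Finset.univ fun i => .pair (.elt (o i).1) (o i).2

/-- `G` is a relaxed predicative zero-sharing for the predicate `Q` among the parties `P`. It is
correct: the shares are statistically indistinguishable from those of the ideal functionality. It is
private: from the inputs and the ideal shares of a proper subset of the parties, a simulator produces
what this subset receives (shares and hints), up to computational indistinguishability. The secret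
need not be independent of what the subset receives. -/
structure IsRelaxedPZS [Nonempty P] (enc : ∀ κ, F κ ↪ List Bool) (Q : (P → Input) → Prop)
    (G : (κ : ℕ) → (P → Input) → PMF (P → F κ × Val (F κ))) : Prop where
  polyTime : PolyTimeFunctionality enc G
  correct : StatIndist (fun κ x => (G κ x).map fun o i => (o i).1)
    (fun κ x => (idealPZS (Q x) : PMF (P → F κ)))
  priv : ∃ Sim : Prog, PolyTimeSim (P := P) enc Sim ∧
    ∀ C : Finset P, C ≠ Finset.univ →
      CompIndist enc
        (fun κ x => (idealPZS (Q x) : PMF (P → F κ)).bind fun s =>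
          Sim.run (enc κ) (simInput κ C x s))
        (fun κ x => (G κ x).map fun o => restrictTo C fun i => .pair (.elt (o i).1) (o i).2)

/-- The protocol `Π`, which yields the views and the outputs of all parties, securely realizes
predicative zero-sharing for `Q` against every semi-honest adversary that corrupts a proper subset of
the parties: one simulator serves all corrupted sets, and the simulated view together with the ideal
outputs of all parties is computationally indistinguishable from the real view of the corrupted
parties together with the real outputs of all parties. -/
def SecurelyRealizesPZS [Nonempty P] (enc : ∀ κ, F κ ↪ List Bool) (Q : (P → Input) → Prop)
    (prot : (κ : ℕ) → (P → Input) → PMF ((P → List (Val (F κ))) × (P → F κ))) : Prop :=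
  ∃ Sim : Prog, PolyTimeSim (P := P) enc Sim ∧
    ∀ C : Finset P, C ≠ Finset.univ →
      CompIndist enc
        (fun κ x => (idealPZS (Q x) : PMF (P → F κ)).bind fun s =>
          (Sim.run (enc κ) (simInput κ C x s)).map fun w => .pair w (sharesVal s))
        (fun κ x => (prot κ x).map fun o =>
          .pair (restrictTo C fun i => .ofList (o.1 i)) (sharesVal o.2))

end Security

/-! ### Compound predicates -/

/-- Formulas over the connectives `∧` and `∨`. -/
inductive Formula (α : Type 1) : Type 1
  | lit (a : α) : Formula α
  | and (φ ψ : Formula α) : Formula α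
  | or (φ ψ : Formula α) : Formula α

namespace Formula

variable {α : Type 1}

/-- The literals `Q₁, …, Q_q` of a formula, one for each occurrence. -/
def literals : Formula α → List α
  | lit a => [a]
  | and φ ψ => φ.literals ++ ψ.literals
  | or φ ψ => φ.literals ++ ψ.literals

/-- The number of `∨` operators. -/
def numOr : Formula α → ℕ
  | lit _ => 0
  | and φ ψ => φ.numOr + ψ.numOr
  | or φ ψ => φ.numOr + ψ.numOr + 1

/-- The truth value, given those of the literals. -/
def Holds (t : α → Prop) : Formula α → Prop
  | lit a => t a
  | and φ ψ => φ.Holds t ∧ ψ.Holds t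
  | or φ ψ => φ.Holds t ∨ ψ.Holds t

end Formula

/-- A literal: the parties that it involves, a predicate on their inputs (a simple predicate or its
negation), and the functionality that the involved parties call for it, which gives each of them a
share and a hint. -/
structure Literal (F : ℕ → Type) (m : ℕ) : Type 1 where
  parties : Finset (Fin m)
  nonempty : parties.Nonempty
  pred : (parties → Input) → Prop
  func : (κ : ℕ) → (parties → Input) → PMF (parties → F κ × Val (F κ))

instance {F : ℕ → Type} {m : ℕ} (ℓ : Literal F m) : Nonempty ℓ.parties := ℓ.nonempty.to_subtype

/-- The compound predicate on the inputs of all parties that a formula defines. -/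
def Formula.pred {F : ℕ → Type} {m : ℕ} (φ : Formula (Literal F m)) (x : Fin m → Input) : Prop :=
  φ.Holds fun ℓ => ℓ.pred fun i => x i

/-- The statistical distance between the shares that the functionality of a literal gives out and
ideal shares. -/
noncomputable def Literal.error {F : ℕ → Type} [∀ κ, Field (F κ)] [∀ κ, Fintype (F κ)] {m : ℕ}
    (ℓ : Literal F m) (κ : ℕ) (x : Fin m → Input) : ℝ :=
  tvDist ((ℓ.func κ fun i => x i).map fun o i => (o i).1) (idealPZS (ℓ.pred fun i => x i))

/-! ### The protocol -/

section Protocol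

variable {m : ℕ} [NeZero m] {F : Type} [Field F] [Fintype F]

/-- The messages that the parties receive when an additively shared value is opened: all other
parties send their shares to the leader (party `0`), who sends the sum to all other parties. -/
def opening (w : Fin m → F) (i : Fin m) : List (Val F) :=
  if i = 0 then ((List.finRange m).filter (· ≠ 0)).map fun j => Val.elt (w j)
  else [Val.elt (∑ j, w j)]

/-- A Beaver triple `([a], [b], [c])` from the offline phase: `[a]` and `[b]` are uniformly random
sharings and `[c]` is a uniformly random sharing of `a * b`. -/
noncomputable def beaverTriple : PMF ((Fin m → F) × (Fin m → F) × (Fin m → F)) := do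
  let a ← PMF.uniformOfFintype (Fin m → F)
  let b ← PMF.uniformOfFintype (Fin m → F)
  let c ← uniformSharing ((∑ i, a i) * ∑ i, b i)
  return (a, b, c)

/-- Secure multiplication `[r] * [r']` with a fresh Beaver triple: open `d = r - a` and
`e = r' - b`, and output shares of `c + d * b + e * a + d * e`. Returns the shares and what each party
receives. -/
noncomputable def secureMul (r r' : Fin m → F) :
    PMF ((Fin m → F) × (Fin m → List (Val F))) := do
  let (a, b, c) ← beaverTriple
  let d := ∑ i, (r i - a i)
  let e := ∑ i, (r' i - b i)
  return (fun i => c i + d * b i + e * a i + (if i = 0 then d * e else 0),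
    fun i => [.elt (a i), .elt (b i), .elt (c i)] ++
      opening (fun j => r j - a j) i ++ opening (fun j => r' j - b j) i)

/-- The transformation `[s] = [r] * [b]` from relaxed to standard, where the random multiplier `[b]`
is that of a Beaver triple: open `u = r + a`, and output shares of `u * b - c`. -/
noncomputable def transformation (r : Fin m → F) :
    PMF ((Fin m → F) × (Fin m → List (Val F))) := do
  let (a, b, c) ← beaverTriple
  let u := ∑ i, (r i + a i)
  return (fun i => u * b i - c i,
    fun i => [.elt (a i), .elt (b i), .elt (c i)] ++ opening (fun j => r j + a j) i)

end Protocol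

section Protocol

variable {m : ℕ} [NeZero m] {F : ℕ → Type} [∀ κ, Field (F κ)] [∀ κ, Fintype (F κ)]

/-- The sharing stage and the formula emulation stage: every literal is shared by one fresh call of
its functionality (uninvolved parties set their shares to `0`), `∧` adds shares locally and `∨`
multiplies them securely. Returns the shares of the parties and what they receive, listed along the
formula. -/
noncomputable def emulation (κ : ℕ) (x : Fin m → Input) :
    Formula (Literal F m) → PMF ((Fin m → F κ) × (Fin m → List (Val (F κ))))
  | .lit ℓ => do
      let o ← ℓ.func κ fun i => x i
      return (fun i => if h : i ∈ ℓ.parties then (o ⟨i, h⟩).1 else 0,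
        fun i => if h : i ∈ ℓ.parties then [.elt (o ⟨i, h⟩).1, (o ⟨i, h⟩).2] else [])
  | .and φ ψ => do
      let (r, v) ← emulation κ x φ
      let (r', v') ← emulation κ x ψ
      return (fun i => r i + r' i, fun i => v i ++ v' i)
  | .or φ ψ => do
      let (r, v) ← emulation κ x φ
      let (r', v') ← emulation κ x ψ
      let (t, w) ← secureMul r r'
      return (t, fun i => v i ++ v' i ++ w i)

/-- The compound predicative zero-sharing protocol. The view of a party consists of its input and of
everything that it received or sampled. -/
noncomputable def protocol (φ : Formula (Literal F m)) (κ : ℕ) (x : Fin m → Input) :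
    PMF ((Fin m → List (Val (F κ))) × (Fin m → F κ)) := do
  let (r, v) ← emulation κ x φ
  let (s, w) ← transformation r
  return (fun i => Val.ofBits (x i) :: (v i ++ w i), s)

end Protocol

end PZS

set_option linter.unusedSectionVars false

namespace PZS

/-! ### Real-valued estimates for probability mass functions -/

section RealEstimates

/-! Correctness. The secrets of two subformulas are independent. Their sum is zero if both are zero
and uniform as soon as one is uniform, so `∧` is exact. Their product is zero if one factor is; if
both are uniform, it is uniform given that the first factor is nonzero, so each `∨` costs at most
`1/|F|`. Data processing and induction give `tvDist_secret`. The last step outputs a sharing of `r *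
b` with `b` uniform. Given `r` this is a uniform sharing of zero if `r = 0` and a uniform vector
otherwise, so the output law is wrong only through an accidental zero of a uniform `r`, which costs
another `1/|F|` (`tvDist_output`).

Privacy has three layers. The first is perfect. Fix a proper subset `C`. The honest shares of the
Beaver masks are uniform, so they can be renamed to be the honest messages in the openings; a
sharing of the product `ab` looks uniform to `C`; and the output shares `s` determine the shares of
`c` in the last triple. Hence (`protocol_map`), given the outputs `o` of the literal
functionalities, the output shares are ideal shares for the predicate `secret φ o = 0`, and the view
of `C` is sampled from `s` and from what `C` receives of `o`.

The second layer is statistical: `secret φ o = 0` is replaced by the truth value of the formula. The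
two disagree with negligible probability (`secret_wrong_le`), and this is where the correctness of
the literals enters. Afterwards `s` and `o` are independent, although the hints may well reveal the
secret.

The third layer is computational: the real `o` is replaced by simulated ones. A literal with all of
its parties in `C` is simulated by running its functionality; any other by its own simulator on
uniform shares, since the ideal shares of a proper subset are uniform for either truth value. As `s`
is now independent of `o`, it can be fixed as part of the distinguisher's advice
(`CompIndist.process`), so that its law need not be efficiently samplable.

Running times are handled by the predicates `ConstCost`, `Det` and `PolyCost`, which assert that a
program exists and are closed under composition. Parties and formula are fixed, so assembling the
views takes constant time and the corrupted set can be found by a finite case distinction. -/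

theorem summable_toReal {α : Type} (X : PMF α) : Summable fun a => (X a).toReal :=
  ENNReal.summable_toReal X.tsum_coe_ne_top

theorem tsum_toReal_eq_one {α : Type} (X : PMF α) : ∑' a, (X a).toReal = 1 := by
  rw [← ENNReal.tsum_toReal_eq X.apply_ne_top, X.tsum_coe, ENNReal.toReal_one]

theorem toReal_apply_le_one {α : Type} (X : PMF α) (a : α) : (X a).toReal ≤ 1 := by
  simpa using ENNReal.toReal_mono ENNReal.one_ne_top (X.coe_le_one a)

theorem bind_toReal {α β : Type} (X : PMF α) (f : α → PMF β) (b : β) :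
    (X.bind f b).toReal = ∑' a, (X a).toReal * (f a b).toReal := by
  rw [PMF.bind_apply, ENNReal.tsum_toReal_eq fun a =>
    ENNReal.mul_ne_top (X.apply_ne_top a) ((f a).apply_ne_top b)]
  simp only [ENNReal.toReal_mul]

/-- Views live in the infinite type `Val F`, so expectations are genuine series. This is the
summability needed to split or compare them. -/
theorem summable_toReal_mul {α : Type} (X : PMF α) {h : α → ℝ} {c : ℝ} (h0 : ∀ a, |h a| ≤ c) :
    Summable fun a => (X a).toReal * h a := by
  refine Summable.of_norm_bounded ((summable_toReal X).mul_right c) fun a => ?_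
  rw [Real.norm_eq_abs, abs_mul, abs_of_nonneg ENNReal.toReal_nonneg]
  exact mul_le_mul_of_nonneg_left (h0 a) ENNReal.toReal_nonneg

theorem abs_toReal_sub_le_one {α β : Type} (p : PMF α) (q : PMF β) (a : α) (b : β) :
    |(p a).toReal - (q b).toReal| ≤ 1 := by
  have h1 := toReal_apply_le_one p a
  have h2 := toReal_apply_le_one q b
  have h3 : 0 ≤ (p a).toReal := ENNReal.toReal_nonneg
  have h4 : 0 ≤ (q b).toReal := ENNReal.toReal_nonneg
  rw [abs_le]; constructor <;> linarith

theorem abs_bind_sub_le_tsum {α β : Type} (X : PMF α) (f g : α → PMF β) (b : β) :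
    |(X.bind f b).toReal - (X.bind g b).toReal| ≤
      ∑' a, (X a).toReal * |(f a b).toReal - (g a b).toReal| := by
  have hs : ∀ f : α → PMF β, Summable fun a => (X a).toReal * (f a b).toReal := fun f =>
    summable_toReal_mul X (c := 1) fun a => by
      rw [abs_of_nonneg ENNReal.toReal_nonneg]; exact toReal_apply_le_one _ _
  rw [bind_toReal, bind_toReal, ← (hs f).tsum_sub (hs g)]
  have hb : Summable fun a => (X a).toReal * |(f a b).toReal - (g a b).toReal| :=
    summable_toReal_mul X (c := 1) fun a => by
      rw [abs_abs]; exact abs_toReal_sub_le_one _ _ _ _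
  have he : ∀ a, |(X a).toReal * (f a b).toReal - (X a).toReal * (g a b).toReal| =
      (X a).toReal * |(f a b).toReal - (g a b).toReal| := fun a => by
    rw [← mul_sub, abs_mul, abs_of_nonneg ENNReal.toReal_nonneg]
  have := norm_tsum_le_tsum_norm
    (f := fun a => (X a).toReal * (f a b).toReal - (X a).toReal * (g a b).toReal)
    (by simpa only [Real.norm_eq_abs, he] using hb)
  simpa only [Real.norm_eq_abs, he] using this

/-- Averaging: a bound that holds conditionally on every value of `X` holds on average. -/
theorem abs_bind_sub_le {α β : Type} (X : PMF α) (f g : α → PMF β) (b : β) {μ : ℝ}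
    (h : ∀ a, |(f a b).toReal - (g a b).toReal| ≤ μ) :
    |(X.bind f b).toReal - (X.bind g b).toReal| ≤ μ := by
  refine (abs_bind_sub_le_tsum X f g b).trans ?_
  have hb : Summable fun a => (X a).toReal * |(f a b).toReal - (g a b).toReal| :=
    summable_toReal_mul X (c := 1) fun a => by
      rw [abs_abs]; exact abs_toReal_sub_le_one _ _ _ _
  calc _ ≤ ∑' a, (X a).toReal * μ :=
        hb.tsum_le_tsum (fun a => mul_le_mul_of_nonneg_left (h a) ENNReal.toReal_nonneg)
          ((summable_toReal X).mul_right μ)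
    _ = μ := by rw [tsum_mul_right, tsum_toReal_eq_one, one_mul]

/-- Two processes that agree outside of an event differ by at most its probability. -/
theorem abs_bind_sub_le_event {α β : Type} (X : PMF α) (f g : α → PMF β) (b : β) (B : α → Prop)
    (h : ∀ a, ¬ B a → f a = g a) :
    |(X.bind f b).toReal - (X.bind g b).toReal| ≤ ((X.map B) True).toReal := by
  refine (abs_bind_sub_le_tsum X f g b).trans ?_
  have hb : Summable fun a => (X a).toReal * |(f a b).toReal - (g a b).toReal| :=
    summable_toReal_mul X (c := 1) fun a => by
      rw [abs_abs]; exact abs_toReal_sub_le_one _ _ _ _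
  have hc : Summable fun a => (X a).toReal * ((PMF.pure (B a)) True).toReal :=
    summable_toReal_mul X (c := 1) fun a => by
      rw [abs_of_nonneg ENNReal.toReal_nonneg]; exact toReal_apply_le_one _ _
  rw [show X.map B = X.bind fun a => PMF.pure (B a) from rfl, bind_toReal]
  refine hb.tsum_le_tsum (fun a => mul_le_mul_of_nonneg_left ?_ ENNReal.toReal_nonneg) hc
  by_cases hB : B a
  · simpa [PMF.pure_apply, hB] using abs_toReal_sub_le_one (f a) (g a) b b
  · simp [h a hB]

end RealEstimates

/-! ### Total variation distance -/

section TvDist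

variable {α β γ : Type} [Fintype α] [Fintype β] [Fintype γ]

theorem bind_toReal_fintype (X : PMF α) (f : α → PMF β) (b : β) :
    (X.bind f b).toReal = ∑ a, (X a).toReal * (f a b).toReal := by
  rw [bind_toReal, tsum_fintype]

theorem sum_toReal (X : PMF α) : ∑ a, (X a).toReal = 1 := by
  rw [← tsum_toReal_eq_one X, tsum_fintype]

theorem tvDist_self (p : PMF α) : tvDist p p = 0 := by simp [tvDist]

theorem tvDist_triangle (p q r : PMF α) : tvDist p r ≤ tvDist p q + tvDist q r := by
  unfold tvDist
  rw [← add_div, ← Finset.sum_add_distrib]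
  exact div_le_div_of_nonneg_right (Finset.sum_le_sum fun a _ => abs_sub_le _ _ _) (by norm_num)

theorem tvDist_le_one (p q : PMF α) : tvDist p q ≤ 1 := by
  have : ∑ a, |(p a).toReal - (q a).toReal| ≤ ∑ a, ((p a).toReal + (q a).toReal) :=
    Finset.sum_le_sum fun a _ => (abs_sub _ _).trans_eq (by
      rw [abs_of_nonneg ENNReal.toReal_nonneg, abs_of_nonneg ENNReal.toReal_nonneg])
  rw [Finset.sum_add_distrib, sum_toReal, sum_toReal] at this
  unfold tvDist
  linarith

/-- Data processing. -/
theorem tvDist_bind_le (p q : PMF α) (k : α → PMF β) :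
    tvDist (p.bind k) (q.bind k) ≤ tvDist p q := by
  unfold tvDist
  refine div_le_div_of_nonneg_right ?_ (by norm_num)
  calc ∑ b, |(p.bind k b).toReal - (q.bind k b).toReal|
      ≤ ∑ b, ∑ a, |(p a).toReal - (q a).toReal| * (k a b).toReal := by
        refine Finset.sum_le_sum fun b _ => ?_
        rw [bind_toReal_fintype, bind_toReal_fintype, ← Finset.sum_sub_distrib]
        refine (Finset.abs_sum_le_sum_abs _ _).trans (Finset.sum_le_sum fun a _ => ?_)
        rw [← sub_mul, abs_mul, abs_of_nonneg (ENNReal.toReal_nonneg (a := k a b))]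
    _ = ∑ a, |(p a).toReal - (q a).toReal| := by
        rw [Finset.sum_comm]
        exact Finset.sum_congr rfl fun a _ => by rw [← Finset.mul_sum, sum_toReal, mul_one]

theorem tvDist_map_le (p q : PMF α) (f : α → β) : tvDist (p.map f) (q.map f) ≤ tvDist p q :=
  tvDist_bind_le p q _

theorem tvDist_bind_right_le_sum (p : PMF α) (k k' : α → PMF β) :
    tvDist (p.bind k) (p.bind k') ≤ ∑ a, (p a).toReal * tvDist (k a) (k' a) := by
  unfold tvDist
  simp only [← mul_div_assoc]
  rw [← Finset.sum_div]
  refine div_le_div_of_nonneg_right ?_ (by norm_num)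
  calc ∑ b, |(p.bind k b).toReal - (p.bind k' b).toReal|
      ≤ ∑ b, ∑ a, (p a).toReal * |(k a b).toReal - (k' a b).toReal| := by
        refine Finset.sum_le_sum fun b _ => ?_
        rw [bind_toReal_fintype, bind_toReal_fintype, ← Finset.sum_sub_distrib]
        refine (Finset.abs_sum_le_sum_abs _ _).trans (Finset.sum_le_sum fun a _ => ?_)
        rw [← mul_sub, abs_mul, abs_of_nonneg ENNReal.toReal_nonneg]
    _ = _ := by rw [Finset.sum_comm]; simp only [Finset.mul_sum]

theorem tvDist_bind_right_le (p : PMF α) (k k' : α → PMF β) {c : ℝ}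
    (h : ∀ a, tvDist (k a) (k' a) ≤ c) : tvDist (p.bind k) (p.bind k') ≤ c :=
  (tvDist_bind_right_le_sum p k k').trans <| calc
    _ ≤ ∑ a, (p a).toReal * c :=
      Finset.sum_le_sum fun a _ => mul_le_mul_of_nonneg_left (h a) ENNReal.toReal_nonneg
    _ = c := by rw [← Finset.sum_mul, sum_toReal, one_mul]

/-- Only the term at `a₀` survives in the average, and a distance is at most one. The exceptional
value will be the zero of the field, the only multiplier that does not preserve the uniform law. -/
theorem tvDist_bind_right_le_apply (p : PMF α) (k k' : α → PMF β) (a₀ : α)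
    (h : ∀ a, a ≠ a₀ → k a = k' a) : tvDist (p.bind k) (p.bind k') ≤ (p a₀).toReal := by
  classical
  refine (tvDist_bind_right_le_sum p k k').trans ?_
  rw [Finset.sum_eq_single a₀ (fun a _ ha => by rw [h a ha, tvDist_self, mul_zero]) (by simp)]
  exact mul_le_of_le_one_right ENNReal.toReal_nonneg (tvDist_le_one _ _)

/-- A hybrid argument: the two independent inputs are exchanged one after the other. -/
theorem tvDist_bind₂_le (p q : PMF α) (p' q' : PMF β) (f : α → β → PMF γ) :
    tvDist (p.bind fun a => p'.bind (f a)) (q.bind fun a => q'.bind (f a)) ≤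
      tvDist p q + tvDist p' q' := by
  refine (tvDist_triangle _ (q.bind fun a => p'.bind (f a)) _).trans (add_le_add ?_ ?_)
  · exact tvDist_bind_le _ _ _
  · exact tvDist_bind_right_le _ _ _ fun a => tvDist_bind_le _ _ _

theorem map_prop_toReal (p : PMF α) (B : α → Prop) [DecidablePred B] :
    ((p.map B) True).toReal = ∑ a, if B a then (p a).toReal else 0 := by
  rw [show p.map B = p.bind fun a => PMF.pure (B a) from rfl, bind_toReal, tsum_fintype]
  refine Finset.sum_congr rfl fun a _ => ?_
  by_cases h : B a <;> simp [h, PMF.pure_apply]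

/-- The probabilities of an event differ by at most the statistical distance. -/
theorem event_sub_le_tvDist (p q : PMF α) (B : α → Prop) :
    ((p.map B) True).toReal - ((q.map B) True).toReal ≤ tvDist p q := by
  classical
  have h1 : ∑ a, ((p a).toReal - (q a).toReal) = 0 := by
    rw [Finset.sum_sub_distrib, sum_toReal, sum_toReal, sub_self]
  rw [map_prop_toReal, map_prop_toReal, ← Finset.sum_sub_distrib]
  -- The right-hand summand is the positive part of the difference, which dominates the left-hand
  -- one whether or not `a` lies in the event. Its second half sums to zero by `h1`.
  have h2 : ∑ a, ((if B a then (p a).toReal else 0) - if B a then (q a).toReal else 0) ≤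
      ∑ a, (|(p a).toReal - (q a).toReal| / 2 + ((p a).toReal - (q a).toReal) / 2) := by
    refine Finset.sum_le_sum fun a _ => ?_
    have := le_abs_self ((p a).toReal - (q a).toReal)
    have := neg_abs_le ((p a).toReal - (q a).toReal)
    split_ifs <;> linarith
  rw [Finset.sum_add_distrib, ← Finset.sum_div, ← Finset.sum_div, h1] at h2
  simpa [tvDist] using h2

end TvDist

/-! ### Uniform distributions -/

section Uniform

theorem uniform_map_of_card_fiber {α β : Type} [Fintype α] [Nonempty α] [DecidableEq β] (f : α → β)
    (S : Finset β) (hS : S.Nonempty) (n : ℕ) (hf : ∀ a, f a ∈ S)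
    (hn : ∀ b ∈ S, (Finset.univ.filter fun a => f a = b).card = n) :
    (PMF.uniformOfFintype α).map f = PMF.uniformOfFinset S hS := by
  have hcard : Fintype.card α = S.card * n := by
    rw [← Finset.card_univ, Finset.card_eq_sum_card_fiberwise (f := f) (t := S)
      (fun a _ => hf a), Finset.sum_const_nat hn]
  have hn0 : n ≠ 0 := fun h => Fintype.card_ne_zero (α := α) (by rw [hcard, h, mul_zero])
  ext b
  rw [PMF.map_apply, tsum_fintype, PMF.uniformOfFinset_apply]
  simp only [PMF.uniformOfFintype_apply, eq_comm (a := b)]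
  rw [← Finset.sum_filter, Finset.sum_const]
  split_ifs with hb
  · rw [hn b hb, hcard, nsmul_eq_mul, Nat.cast_mul, ENNReal.mul_inv (by simp) (by simp), mul_comm,
      mul_assoc, ENNReal.inv_mul_cancel (by simpa using hn0) (by simp), mul_one]
  · rw [Finset.filter_eq_empty_iff.2 (by rintro a - rfl; exact hb (hf a))]; simp

theorem uniformOfFinset_univ {α : Type} [Fintype α] [Nonempty α] :
    PMF.uniformOfFinset (Finset.univ : Finset α) Finset.univ_nonempty =
      PMF.uniformOfFintype α := rfl

theorem uniform_map_bijective {α β : Type} [Fintype α] [Nonempty α] [Fintype β] [Nonempty β]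
    (f : α → β) (hf : f.Bijective) :
    (PMF.uniformOfFintype α).map f = PMF.uniformOfFintype β := by
  classical
  rw [← uniformOfFinset_univ]
  refine uniform_map_of_card_fiber f _ _ 1 (fun _ => Finset.mem_univ _) fun b _ => ?_
  obtain ⟨a, rfl⟩ := hf.2 b
  rw [Finset.card_eq_one]
  exact ⟨a, by ext a'; simp [hf.1.eq_iff]⟩

/-- Change of variables. The masking arguments below come down to exhibiting a bijection for it. -/
theorem uniform_bind_bijective {α β γ : Type} [Fintype α] [Nonempty α] [Fintype β] [Nonempty β]
    (f : α → β) (hf : f.Bijective) (k : β → PMF γ) :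
    ((PMF.uniformOfFintype α).bind fun a => k (f a)) = (PMF.uniformOfFintype β).bind k := by
  rw [← uniform_map_bijective f hf, PMF.bind_map]; rfl

/-- Merges two independent draws, so that bijections mixing both of them can be applied. -/
theorem uniform_prod {α β γ : Type} [Fintype α] [Nonempty α] [Fintype β] [Nonempty β]
    (k : α → β → PMF γ) :
    ((PMF.uniformOfFintype α).bind fun a => (PMF.uniformOfFintype β).bind (k a)) =
      (PMF.uniformOfFintype (α × β)).bind fun p => k p.1 p.2 := by
  ext c
  simp only [PMF.bind_apply, tsum_fintype, PMF.uniformOfFintype_apply, Fintype.card_prod,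
    Fintype.sum_prod_type, Finset.mul_sum, ← mul_assoc]
  rw [Nat.cast_mul, ENNReal.mul_inv (by simp) (by simp)]

/-! ### Additive sharings and ideal shares -/

variable {P : Type} [Fintype P] [DecidableEq P] {F : Type} [Field F] [Fintype F]

/-- Shift the coordinate `j` of a vector so that the entries have sum `v`. -/
def adjust (j : P) (v : F) (s : P → F) : P → F := s + Pi.single j (v - ∑ i, s i)

theorem sum_adjust (j : P) (v : F) (s : P → F) : ∑ i, adjust j v s i = v := by
  simp [adjust, Finset.sum_add_distrib]

theorem adjust_apply_of_ne {j i : P} (h : i ≠ j) (v : F) (s : P → F) : adjust j v s i = s i := by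
  simp [adjust, h]

/-- The fibres of `adjust j v` are the lines in direction `j`, all of size `|F|`. With `j` an honest
party, the corrupted coordinates of a uniform sharing are those of a uniform vector, whatever `v`
is. -/
theorem uniformSharing_eq_map [Nonempty P] (j : P) (v : F) :
    (uniformSharing v : PMF (P → F)) = (PMF.uniformOfFintype (P → F)).map (adjust j v) := by
  classical
  let _ : DecidableEq (P → F) := Classical.decEq _
  refine (uniform_map_of_card_fiber (adjust j v) _ (sharings_nonempty v) (Fintype.card F)
    (fun s => by simp [sum_adjust]) fun s hs => ?_).symm
  rw [Finset.mem_filter] at hs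
  symm
  rw [← Finset.card_univ]
  refine Finset.card_bij (fun t _ => s + Pi.single j t) (fun t _ => ?_) (fun t _ t' _ h => ?_)
    fun s' hs' => ?_
  · rw [Finset.mem_filter]
    refine ⟨Finset.mem_univ _, ?_⟩
    ext i
    by_cases h : i = j
    · subst h; simp [adjust, Finset.sum_add_distrib, hs.2]
    · simp [adjust, h]
  · simpa using congrFun h j
  · rw [Finset.mem_filter] at hs'
    refine ⟨s' j - s j, Finset.mem_univ _, ?_⟩
    ext i
    by_cases h : i = j
    · subst h; simp
    · rw [← hs'.2, Pi.add_apply, adjust_apply_of_ne h]; simp [h]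

/-- Resampling one coordinate exchanges it with a fresh uniform element, and this exchange is a
bijection on pairs. -/
theorem uniform_update {α : Type} (i : P) (k : (P → F) → PMF α) :
    (PMF.uniformOfFintype (P → F)).bind k = (PMF.uniformOfFintype F).bind fun x =>
      (PMF.uniformOfFintype (P → F)).bind fun s => k (Function.update s i x) := by
  -- A dummy draw gives both sides the same sample space.
  have : (PMF.uniformOfFintype (P → F)).bind k =
      (PMF.uniformOfFintype F).bind fun _ => (PMF.uniformOfFintype (P → F)).bind k := by
    rw [PMF.bind_const]
  rw [this, uniform_prod (fun _ s => k s), uniform_prod (fun x s => k (Function.update s i x)),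
    ← uniform_bind_bijective (fun p : F × (P → F) => (p.2 i, Function.update p.2 i p.1))]
  rw [← Finite.injective_iff_bijective]
  rintro ⟨x, s⟩ ⟨x', s'⟩ h
  simp only [Prod.mk.injEq] at h
  have hx : x = x' := by simpa using congrFun h.2 i
  refine Prod.ext hx (funext fun j => ?_)
  by_cases hj : j = i
  · subst hj; exact h.1
  · simpa [hj] using congrFun h.2 j

/-- Given all other coordinates, the sum is a translate of the resampled one. -/
theorem uniform_map_sum [Nonempty P] :
    (PMF.uniformOfFintype (P → F)).map (fun s => ∑ i, s i) = PMF.uniformOfFintype F := by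
  obtain ⟨j⟩ := ‹Nonempty P›
  rw [show (PMF.uniformOfFintype (P → F)).map (fun s => ∑ i, s i) =
    (PMF.uniformOfFintype (P → F)).bind fun s => PMF.pure (∑ i, s i) from rfl,
    uniform_update j, PMF.bind_comm]
  have : ∀ s : P → F, ((PMF.uniformOfFintype F).bind fun x =>
      PMF.pure (∑ i, Function.update s j x i)) = PMF.uniformOfFintype F := fun s => by
    refine (uniform_bind_bijective (fun x => ∑ i, Function.update s j x i) ?_ PMF.pure).trans
      (PMF.bind_pure _)
    rw [← Finite.injective_iff_bijective]
    intro x x' h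
    simpa [Finset.sum_update_of_mem] using h
  simp only [this, PMF.bind_const]

theorem idealPZS_true [Nonempty P] {Q : Prop} (h : Q) :
    (idealPZS Q : PMF (P → F)) = uniformSharing 0 := if_pos h

theorem idealPZS_false [Nonempty P] {Q : Prop} (h : ¬ Q) :
    (idealPZS Q : PMF (P → F)) = PMF.uniformOfFintype (P → F) := by
  rw [idealPZS, if_neg h]
  congr!

theorem idealSecret_true {Q : Prop} (h : Q) : (idealSecret Q : PMF F) = PMF.pure 0 := if_pos h

theorem idealSecret_false {Q : Prop} (h : ¬ Q) :
    (idealSecret Q : PMF F) = PMF.uniformOfFintype F := if_neg h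

theorem idealPZS_map_sum [Nonempty P] (Q : Prop) :
    (idealPZS Q : PMF (P → F)).map (fun s => ∑ i, s i) = idealSecret Q := by
  by_cases h : Q
  · obtain ⟨j⟩ := ‹Nonempty P›
    rw [idealPZS_true h, idealSecret_true h, uniformSharing_eq_map j, PMF.map_comp,
      show (fun s : P → F => ∑ i, s i) ∘ adjust j 0 = Function.const _ 0 from
        funext fun s => sum_adjust j 0 s, PMF.map_const]
  · rw [idealPZS_false h, idealSecret_false h, uniform_map_sum]

/-- The ideal shares of a proper subset of the parties are uniform. -/
theorem idealPZS_bind_congr [Nonempty P] {α : Type} (Q : Prop) (C : Finset P)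
    (hC : C ≠ Finset.univ) (k : (P → F) → PMF α)
    (hk : ∀ s s' : P → F, (∀ i ∈ C, s i = s' i) → k s = k s') :
    (idealPZS Q).bind k = (PMF.uniformOfFintype (P → F)).bind k := by
  by_cases h : Q
  -- A party `j` outside of `C` absorbs the correction of the sum.
  · obtain ⟨j, hj⟩ : ∃ j, j ∉ C := by simpa [Finset.eq_univ_iff_forall] using hC
    rw [idealPZS_true h, uniformSharing_eq_map j, PMF.bind_map]
    exact congrArg _ (funext fun s => hk _ _ fun i hi =>
      adjust_apply_of_ne (fun h : i = j => hj (h ▸ hi)) _ _)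
  · rw [idealPZS_false h]

end Uniform

/-! ### Perfect simulation of the protocol from the outputs of the literals -/

section LocalSimulation

variable {m : ℕ} [NeZero m] {F : Type} [Field F] [Fintype F]

/-- The part of a sharing that the parties in `C` hold. -/
def restrictShares (C : Finset (Fin m)) (r : Fin m → F) (i : Fin m) : F := if i ∈ C then r i else 0

/-- The views of the parties in `C`. -/
def restrictViews (C : Finset (Fin m)) (v : Fin m → List (Val F)) (i : Fin m) : List (Val F) :=
  if i ∈ C then v i else []

/-- The shares of `[r] - [a]`, where those of the parties outside of `C` are given by `a`. -/
def maskSub (C : Finset (Fin m)) (r a : Fin m → F) (j : Fin m) : F :=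
  if j ∈ C then r j - a j else a j

/-- The shares of `[r] + [a]`, where those of the parties outside of `C` are given by `a`. -/
def maskAdd (C : Finset (Fin m)) (r a : Fin m → F) (j : Fin m) : F :=
  if j ∈ C then r j + a j else a j

/-- What the parties in `C` hold and receive in a secure multiplication. -/
noncomputable def mulResult (C : Finset (Fin m)) (r r' a b c : Fin m → F) :
    (Fin m → F) × (Fin m → List (Val F)) :=
  let w := maskSub C r a
  let w' := maskSub C r' b
  (restrictShares C fun i => c i + (∑ j, w j) * b i + (∑ j, w' j) * a i +
      (if i = 0 then (∑ j, w j) * ∑ j, w' j else 0),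
    restrictViews C fun i => [.elt (a i), .elt (b i), .elt (c i)] ++ opening w i ++ opening w' i)

/-- The triple is drawn as three independent uniform vectors, because a proper subset does not see
the relation `c = ab`. Outside of `C`, the entries of `a` and `b` stand for the honest shares of the
opened differences. -/
noncomputable def simMul (C : Finset (Fin m)) (r r' : Fin m → F) :
    PMF ((Fin m → F) × (Fin m → List (Val F))) :=
  (PMF.uniformOfFintype (Fin m → F)).bind fun a => (PMF.uniformOfFintype (Fin m → F)).bind fun b =>
    (PMF.uniformOfFintype (Fin m → F)).bind fun c => PMF.pure (mulResult C r r' a b c)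

/-- What the parties in `C` receive in the transformation, given the shares `s` that they output. -/
noncomputable def transView (C : Finset (Fin m)) (r s a b : Fin m → F) : Fin m → List (Val F) :=
  restrictViews C fun i =>
    [.elt (a i), .elt (b i), .elt ((∑ j, maskAdd C r a j) * b i - s i)] ++ opening (maskAdd C r a) i

/-- No sharing of `c` is sampled: the prescribed output forces `c i = u * b i - s i`. -/
noncomputable def simTrans (C : Finset (Fin m)) (r s : Fin m → F) : PMF (Fin m → List (Val F)) :=
  (PMF.uniformOfFintype (Fin m → F)).bind fun a => (PMF.uniformOfFintype (Fin m → F)).bind fun b =>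
    PMF.pure (transView C r s a b)

theorem secureMul_eq_bind (r r' : Fin m → F) :
    secureMul r r' = (PMF.uniformOfFintype (Fin m → F)).bind fun a =>
      (PMF.uniformOfFintype (Fin m → F)).bind fun b =>
        (uniformSharing ((∑ i, a i) * ∑ i, b i)).bind fun c => PMF.pure
          (fun i => c i + (∑ i, (r i - a i)) * b i + (∑ i, (r' i - b i)) * a i +
              (if i = 0 then (∑ i, (r i - a i)) * (∑ i, (r' i - b i)) else 0),
            fun i => [.elt (a i), .elt (b i), .elt (c i)] ++
              opening (fun j => r j - a j) i ++ opening (fun j => r' j - b j) i) := by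
  simp only [secureMul, beaverTriple, Bind.bind, Pure.pure, PMF.bind_bind, PMF.pure_bind]

theorem transformation_eq_bind (r : Fin m → F) :
    transformation r = (PMF.uniformOfFintype (Fin m → F)).bind fun a =>
      (PMF.uniformOfFintype (Fin m → F)).bind fun b =>
        (uniformSharing ((∑ i, a i) * ∑ i, b i)).bind fun c => PMF.pure
          (fun i => (∑ i, (r i + a i)) * b i - c i,
            fun i => [.elt (a i), .elt (b i), .elt (c i)] ++ opening (fun j => r j + a j) i) := by
  simp only [transformation, beaverTriple, Bind.bind, Pure.pure, PMF.bind_bind, PMF.pure_bind]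

/-- The honest mask `a j` is replaced by the honest message `r j - a j`, after which the honest
shares of `r` drop out of the openings. The substitution is an involution. -/
theorem uniform_bind_sub_off {α : Type} (C : Finset (Fin m)) (r : Fin m → F)
    (k : (Fin m → F) → PMF α) :
    (PMF.uniformOfFintype (Fin m → F)).bind k = (PMF.uniformOfFintype (Fin m → F)).bind fun a =>
      k fun j => if j ∈ C then a j else r j - a j := by
  symm
  refine uniform_bind_bijective (fun (a : Fin m → F) j => if j ∈ C then a j else r j - a j) ?_ k
  refine Function.Involutive.bijective fun a => funext fun j => ?_
  by_cases h : j ∈ C <;> simp [h]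

theorem uniform_bind_add_off {α : Type} (C : Finset (Fin m)) (r : Fin m → F)
    (k : (Fin m → F) → PMF α) :
    (PMF.uniformOfFintype (Fin m → F)).bind k = (PMF.uniformOfFintype (Fin m → F)).bind fun a =>
      k fun j => if j ∈ C then a j else a j - r j := by
  symm
  refine uniform_bind_bijective (fun (a : Fin m → F) j => if j ∈ C then a j else a j - r j) ?_ k
  rw [← Finite.injective_iff_bijective]
  refine fun a a' h => funext fun j => ?_
  have := congrFun h j
  by_cases hj : j ∈ C <;> simpa [hj] using this

theorem exists_notMem_of_ne_univ {P : Type} [Fintype P] {C : Finset P} (hC : C ≠ Finset.univ) :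
    ∃ j, j ∉ C := by
  simpa [Finset.eq_univ_iff_forall] using hC

theorem restrictShares_congr {C : Finset (Fin m)} {r r' : Fin m → F} (h : ∀ i ∈ C, r i = r' i) :
    restrictShares C r = restrictShares C r' :=
  funext fun i => by by_cases hi : i ∈ C <;> simp [restrictShares, hi, h]

theorem restrictViews_congr {C : Finset (Fin m)} {v v' : Fin m → List (Val F)}
    (h : ∀ i ∈ C, v i = v' i) : restrictViews C v = restrictViews C v' :=
  funext fun i => by by_cases hi : i ∈ C <;> simp [restrictViews, hi, h]

theorem maskSub_restrictShares (C : Finset (Fin m)) (r a : Fin m → F) :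
    maskSub C (restrictShares C r) a = maskSub C r a :=
  funext fun i => by by_cases hi : i ∈ C <;> simp [restrictShares, maskSub, hi]

theorem maskAdd_restrictShares (C : Finset (Fin m)) (r a : Fin m → F) :
    maskAdd C (restrictShares C r) a = maskAdd C r a :=
  funext fun i => by by_cases hi : i ∈ C <;> simp [restrictShares, maskAdd, hi]

/-- The masks read `r` and `r'` only on `C`, so the simulation needs no honest share. -/
theorem simMul_restrictShares (C : Finset (Fin m)) (r r' : Fin m → F) :
    simMul C (restrictShares C r) (restrictShares C r') = simMul C r r' := by
  simp only [simMul, mulResult, maskSub_restrictShares]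

theorem simTrans_restrictShares (C : Finset (Fin m)) (r s : Fin m → F) :
    simTrans C (restrictShares C r) s = simTrans C r s := by
  simp only [simTrans, transView, maskAdd_restrictShares]

/-- The law of what a proper subset of the parties sees of a secure multiplication, jointly with the
secret of the result. -/
theorem secureMul_map {C : Finset (Fin m)} (hC : C ≠ Finset.univ) (r r' : Fin m → F) :
    (secureMul r r').map (fun p => (∑ i, p.1 i, restrictShares C p.1, restrictViews C p.2)) =
      (simMul C r r').map fun p => ((∑ i, r i) * ∑ i, r' i, p) := by
  obtain ⟨j, hj⟩ := exists_notMem_of_ne_univ hC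
  have hne : ∀ i ∈ C, i ≠ j := fun i hi h => hj (h ▸ hi)
  rw [secureMul_eq_bind, simMul, uniform_bind_sub_off C r]
  simp only [PMF.map_bind]
  refine congrArg _ (funext fun a => ?_)
  rw [uniform_bind_sub_off C r']
  refine congrArg _ (funext fun b => ?_)
  rw [uniformSharing_eq_map j, PMF.bind_map]
  refine congrArg _ (funext fun c => ?_)
  simp only [Function.comp, PMF.pure_map]
  have hw : ∀ r a : Fin m → F, (fun j => r j - if j ∈ C then a j else r j - a j) = maskSub C r a :=
    fun r a => funext fun i => by by_cases hi : i ∈ C <;> simp [maskSub, hi]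
  have hw' : ∀ r a : Fin m → F, (∑ j, (r j - if j ∈ C then a j else r j - a j)) =
    ∑ j, maskSub C r a j := fun r a => by rw [← hw]
  congr 1
  refine Prod.ext ?_ (Prod.ext ?_ ?_)
  -- Beaver's identity: with `d = r - a` and `e = r' - b`, one has `ab + db + ea + de = rr'`.
  · simp only [Finset.sum_add_distrib, sum_adjust, ← Finset.mul_sum, Finset.sum_ite_eq',
      Finset.mem_univ, if_true, Finset.sum_sub_distrib]
    ring
  · refine restrictShares_congr fun i hi => ?_
    simp only [hw', adjust_apply_of_ne (hne i hi), hi, if_true]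
  · refine restrictViews_congr fun i hi => ?_
    simp only [hw, adjust_apply_of_ne (hne i hi), hi, if_true]

/-- The affine map `c ↦ u * b - c` takes sharings to sharings and keeps the correction at the
coordinate `j`. -/
theorem sub_adjust (j : Fin m) (v u : F) (b c : Fin m → F) :
    (fun i => u * b i - adjust j v c i) =
      adjust j (u * ∑ i, b i - v) fun i => u * b i - c i := by
  funext i
  simp only [adjust, Pi.add_apply, Finset.sum_sub_distrib, ← Finset.mul_sum]
  by_cases h : i = j
  · subst h; simp; ring
  · simp [h]

/-- The law of what a proper subset of the parties sees of the transformation, jointly with the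
shares of all parties. -/
theorem transformation_map {C : Finset (Fin m)} (hC : C ≠ Finset.univ) (r : Fin m → F) :
    (transformation r).map (fun p => (p.1, restrictViews C p.2)) =
      (idealPZS (∑ i, r i = 0)).bind fun s => (simTrans C r s).map fun w => (s, w) := by
  obtain ⟨j, hj⟩ := exists_notMem_of_ne_univ hC
  have hne : ∀ i ∈ C, i ≠ j := fun i hi h => hj (h ▸ hi)
  have hw : ∀ r a : Fin m → F, (fun j => r j + if j ∈ C then a j else a j - r j) = maskAdd C r a :=
    fun r a => funext fun i => by by_cases hi : i ∈ C <;> simp [maskAdd, hi]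
  have hw' : ∀ r a : Fin m → F, (∑ j, (r j + if j ∈ C then a j else a j - r j)) =
    ∑ j, maskAdd C r a j := fun r a => by rw [← hw]
  -- The output shares become the variable in place of `c`: the map `c ↦ u * b - c` is an
  -- involution, and the new vector has sum `(r + a) * b - a * b = r * b`.
  have hleft : (transformation r).map (fun p => (p.1, restrictViews C p.2)) =
      (PMF.uniformOfFintype (Fin m → F)).bind fun a =>
        (PMF.uniformOfFintype (Fin m → F)).bind fun b =>
          (PMF.uniformOfFintype (Fin m → F)).bind fun c =>
            PMF.pure (adjust j ((∑ i, r i) * ∑ i, b i) c,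
              transView C r (adjust j ((∑ i, r i) * ∑ i, b i) c) a b) := by
    rw [transformation_eq_bind, uniform_bind_add_off C r]
    simp only [PMF.map_bind]
    refine congrArg _ (funext fun a => congrArg _ (funext fun b => ?_))
    rw [uniformSharing_eq_map j, PMF.bind_map,
      ← uniform_bind_bijective (fun c i => (∑ j, maskAdd C r a j) * b i - c i)
        (Function.Involutive.bijective fun c => funext fun i => by simp)]
    refine congrArg _ (funext fun c => ?_)
    simp only [Function.comp, PMF.pure_map, hw]
    have hv : (∑ j, maskAdd C r a j) * ∑ i, b i -
        (∑ i, if i ∈ C then a i else a i - r i) * ∑ i, b i = (∑ i, r i) * ∑ i, b i := by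
      rw [← hw', Finset.sum_add_distrib]; ring
    have hs := sub_adjust j ((∑ i, if i ∈ C then a i else a i - r i) * ∑ i, b i)
      (∑ j, maskAdd C r a j) b fun i => (∑ j, maskAdd C r a j) * b i - c i
    simp only [hv, sub_sub_cancel] at hs
    congr 1
    refine Prod.ext hs (restrictViews_congr fun i hi => ?_)
    rw [← hs]
    simp only [hi, if_true, sub_sub_cancel]
  rw [hleft]
  by_cases h0 : ∑ i, r i = 0
  -- For secret zero the output is a sharing of zero that is independent of `a` and `b`; only the
  -- order of the draws differs.
  · rw [idealPZS_true h0, uniformSharing_eq_map j, PMF.bind_map]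
    simp only [h0, zero_mul, simTrans, Function.comp_def, PMF.map_bind, PMF.pure_map]
    conv_rhs => rw [PMF.bind_comm]
    refine congrArg _ (funext fun a => ?_)
    rw [PMF.bind_comm]
  · rw [idealPZS_false h0]
    simp only [simTrans, PMF.map_bind, PMF.pure_map]
    conv_rhs => rw [PMF.bind_comm]
    refine congrArg _ (funext fun a => ?_)
    rw [uniform_prod fun b c => PMF.pure (adjust j ((∑ i, r i) * ∑ i, b i) c,
        transView C r (adjust j ((∑ i, r i) * ∑ i, b i) c) a b),
      uniform_prod fun s b => PMF.pure (s, transView C r s a b)]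
    -- The view of `C` does not read `b j`, so this slot can store `c j`, which `adjust` forgets.
    -- The old `b j` is recovered from the sum of the output shares, `(∑ r) * ∑ b`, because `∑ r ≠
    -- 0`.
    refine Eq.trans ?_ (uniform_bind_bijective (fun p : (Fin m → F) × (Fin m → F) =>
      (adjust j ((∑ i, r i) * ∑ i, p.1 i) p.2, Function.update p.1 j (p.2 j))) ?_ _)
    · refine congrArg _ (funext fun p => ?_)
      congr 2
      refine restrictViews_congr fun i hi => ?_
      simp only [Function.update_of_ne (hne i hi)]
    · rw [← Finite.injective_iff_bijective]
      rintro ⟨b, c⟩ ⟨b', c'⟩ h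
      simp only [Prod.mk.injEq] at h
      have hb : ∀ i ≠ j, b i = b' i := fun i hi => by simpa [hi] using congrFun h.2 i
      have hc : c = c' := funext fun i => by
        by_cases hi : i = j
        · subst hi; simpa using congrFun h.2 i
        · simpa [adjust, hi] using congrFun h.1 i
      subst hc
      have hs : ∑ i, b i = ∑ i, b' i := by
        simpa [adjust, h0] using congrFun h.1 j
      have hbj : b j = b' j := by
        rw [← Finset.add_sum_erase _ _ (Finset.mem_univ j),
          ← Finset.add_sum_erase _ b' (Finset.mem_univ j),
          Finset.sum_congr rfl fun i hi => hb i (Finset.ne_of_mem_erase hi)] at hs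
        exact add_right_cancel hs
      exact Prod.ext (funext fun i => by
        by_cases hi : i = j
        · subst hi; exact hbj
        · exact hb i hi) rfl

end LocalSimulation

/-! ### Induction over formulas: simulation and errors -/

section FormulaSimulation

variable {m : ℕ} [NeZero m] {F : ℕ → Type} [∀ κ, Field (F κ)] [∀ κ, Fintype (F κ)]

/-- The outputs of all functionalities that are called along a formula. -/
def LitOut : Formula (Literal F m) → ℕ → Type
  | .lit ℓ, κ => ℓ.parties → F κ × Val (F κ)
  | .and φ ψ, κ => LitOut φ κ × LitOut ψ κ
  | .or φ ψ, κ => LitOut φ κ × LitOut ψ κ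

/-- The law of the outputs of independent calls. -/
noncomputable def litLaw (κ : ℕ) (x : Fin m → Input) : (φ : Formula (Literal F m)) → PMF (LitOut φ κ)
  | .lit ℓ => ℓ.func κ fun i => x i
  | .and φ ψ => (litLaw κ x φ).bind fun o => (litLaw κ x ψ).map fun o' => (o, o')
  | .or φ ψ => (litLaw κ x φ).bind fun o => (litLaw κ x ψ).map fun o' => (o, o')

theorem litLaw_and_bind {α : Type} (κ : ℕ) (x : Fin m → Input) (φ ψ : Formula (Literal F m))
    (k : LitOut (.and φ ψ) κ → PMF α) : (litLaw κ x (.and φ ψ)).bind k =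
      (litLaw κ x φ).bind fun o => (litLaw κ x ψ).bind fun o' => k (o, o') :=
  (PMF.bind_bind (litLaw κ x φ) _ k).trans
    (congrArg _ (funext fun _ => PMF.bind_map (litLaw κ x ψ) _ k))

theorem litLaw_or_bind {α : Type} (κ : ℕ) (x : Fin m → Input) (φ ψ : Formula (Literal F m))
    (k : LitOut (.or φ ψ) κ → PMF α) : (litLaw κ x (.or φ ψ)).bind k =
      (litLaw κ x φ).bind fun o => (litLaw κ x ψ).bind fun o' => k (o, o') :=
  litLaw_and_bind κ x φ ψ k

/-- The secret at the end of the formula emulation. -/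
def secret {κ : ℕ} : (φ : Formula (Literal F m)) → LitOut φ κ → F κ
  | .lit _, o => ∑ i, (o i).1
  | .and φ ψ, o => secret φ o.1 + secret ψ o.2
  | .or φ ψ, o => secret φ o.1 * secret ψ o.2

/-- The simulated shares and views of the parties in `C` in the sharing and emulation stages. -/
noncomputable def simEmulation (C : Finset (Fin m)) {κ : ℕ} : (φ : Formula (Literal F m)) →
    LitOut φ κ → PMF ((Fin m → F κ) × (Fin m → List (Val (F κ))))
  | .lit ℓ, o => PMF.pure
      (restrictShares C fun i => if h : i ∈ ℓ.parties then (o ⟨i, h⟩).1 else 0,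
        restrictViews C fun i =>
          if h : i ∈ ℓ.parties then [.elt (o ⟨i, h⟩).1, (o ⟨i, h⟩).2] else [])
  | .and φ ψ, o => (simEmulation C φ o.1).bind fun p => (simEmulation C ψ o.2).map fun p' =>
      (fun i => p.1 i + p'.1 i, fun i => p.2 i ++ p'.2 i)
  | .or φ ψ, o => (simEmulation C φ o.1).bind fun p => (simEmulation C ψ o.2).bind fun p' =>
      (simMul C p.1 p'.1).map fun q => (q.1, fun i => p.2 i ++ p'.2 i ++ q.2 i)

theorem emulation_and (κ : ℕ) (x : Fin m → Input) (φ ψ : Formula (Literal F m)) :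
    emulation κ x (.and φ ψ) = (emulation κ x φ).bind fun p => (emulation κ x ψ).bind fun p' =>
      PMF.pure (fun i => p.1 i + p'.1 i, fun i => p.2 i ++ p'.2 i) := rfl

theorem emulation_or (κ : ℕ) (x : Fin m → Input) (φ ψ : Formula (Literal F m)) :
    emulation κ x (.or φ ψ) = (emulation κ x φ).bind fun p => (emulation κ x ψ).bind fun p' =>
      (secureMul p.1 p'.1).bind fun q =>
        PMF.pure (q.1, fun i => p.2 i ++ p'.2 i ++ q.2 i) := rfl

theorem emulation_lit (κ : ℕ) (x : Fin m → Input) (ℓ : Literal F m) :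
    emulation κ x (.lit ℓ) = (ℓ.func κ fun i => x i).bind fun o => PMF.pure
      (fun i => if h : i ∈ ℓ.parties then (o ⟨i, h⟩).1 else 0,
        fun i => if h : i ∈ ℓ.parties then [.elt (o ⟨i, h⟩).1, (o ⟨i, h⟩).2] else []) := rfl

theorem protocol_eq (φ : Formula (Literal F m)) (κ : ℕ) (x : Fin m → Input) :
    protocol φ κ x = (emulation κ x φ).bind fun p => (transformation p.1).bind fun q =>
      PMF.pure (fun i => Val.ofBits (x i) :: (p.2 i ++ q.2 i), q.1) := rfl

theorem restrictViews_append {K : Type} (C : Finset (Fin m)) (v v' : Fin m → List (Val K)) :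
    restrictViews C (fun i => v i ++ v' i) =
      fun i => restrictViews C v i ++ restrictViews C v' i :=
  funext fun i => by by_cases hi : i ∈ C <;> simp [restrictViews, hi]

theorem restrictShares_add {K : Type} [Field K] (C : Finset (Fin m)) (r r' : Fin m → K) :
    restrictShares C (fun i => r i + r' i) =
      fun i => restrictShares C r i + restrictShares C r' i :=
  funext fun i => by by_cases hi : i ∈ C <;> simp [restrictShares, hi]

/-- The law of what a proper subset of the parties sees of the emulation stage, jointly with the
secret. -/
theorem emulation_map {C : Finset (Fin m)} (hC : C ≠ Finset.univ) (κ : ℕ) (x : Fin m → Input)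
    (φ : Formula (Literal F m)) :
    (emulation κ x φ).map (fun p => (∑ i, p.1 i, restrictShares C p.1, restrictViews C p.2)) =
      (litLaw κ x φ).bind fun o => (simEmulation C φ o).map fun p => (secret φ o, p) := by
  induction φ with
  | lit ℓ =>
    rw [emulation_lit, PMF.map_bind]
    refine congrArg _ (funext fun o => ?_)
    simp only [simEmulation, PMF.pure_map, secret]
    congr 2
    rw [← Finset.sum_subset (Finset.subset_univ ℓ.parties) fun i _ hi => dif_neg hi,
      ← Finset.sum_coe_sort]
    exact Finset.sum_congr rfl fun i _ => dif_pos i.2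
  | and φ ψ ihφ ihψ =>
    have hl : (emulation κ x (.and φ ψ)).map
        (fun p => (∑ i, p.1 i, restrictShares C p.1, restrictViews C p.2)) =
      ((emulation κ x φ).map
        (fun p => (∑ i, p.1 i, restrictShares C p.1, restrictViews C p.2))).bind fun q =>
      ((emulation κ x ψ).map
        (fun p => (∑ i, p.1 i, restrictShares C p.1, restrictViews C p.2))).bind fun q' =>
      PMF.pure (q.1 + q'.1, (fun i => q.2.1 i + q'.2.1 i), fun i => q.2.2 i ++ q'.2.2 i) := by
      rw [emulation_and]
      simp only [PMF.bind_map, PMF.map_bind, PMF.pure_map, Function.comp_def,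
        Finset.sum_add_distrib, restrictViews_append, restrictShares_add]
    rw [hl, ihφ, ihψ, litLaw_and_bind]
    simp only [simEmulation, secret, PMF.map_bind, PMF.bind_map, PMF.bind_bind,
      Function.comp_def, PMF.map_comp]
    refine congrArg _ (funext fun o => ?_)
    -- The simulation for `φ` and the functionality outputs for `ψ` are independent draws, which
    -- occur in different orders on the two sides.
    rw [PMF.bind_comm]
    simp only [← PMF.bind_pure_comp, Function.comp_def]
  | or φ ψ ihφ ihψ =>
    -- By `secureMul_map`, the product depends on its factors only through their secrets and their
    -- corrupted parts, which is what the induction hypotheses describe.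
    have hl : (emulation κ x (.or φ ψ)).map
        (fun p => (∑ i, p.1 i, restrictShares C p.1, restrictViews C p.2)) =
      ((emulation κ x φ).map
        (fun p => (∑ i, p.1 i, restrictShares C p.1, restrictViews C p.2))).bind fun q =>
      ((emulation κ x ψ).map
        (fun p => (∑ i, p.1 i, restrictShares C p.1, restrictViews C p.2))).bind fun q' =>
      (simMul C q.2.1 q'.2.1).map fun t =>
        (q.1 * q'.1, t.1, fun i => q.2.2 i ++ q'.2.2 i ++ t.2 i) := by
      rw [emulation_or]
      simp only [PMF.bind_map, PMF.map_bind, PMF.pure_map, Function.comp_def]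
      refine congrArg _ (funext fun p => congrArg _ (funext fun p' => ?_))
      rw [simMul_restrictShares]
      have := congrArg (PMF.map fun t => (t.1, t.2.1, fun i =>
        restrictViews C p.2 i ++ restrictViews C p'.2 i ++ t.2.2 i)) (secureMul_map hC p.1 p'.1)
      simp only [PMF.map_comp, Function.comp_def] at this
      rw [← this]
      simp only [restrictViews_append]
      rfl
    rw [hl, ihφ, ihψ, litLaw_or_bind]
    simp only [simEmulation, secret, PMF.map_bind, PMF.bind_map, PMF.bind_bind,
      Function.comp_def, PMF.map_comp]
    refine congrArg _ (funext fun o => ?_)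
    rw [PMF.bind_comm]

/-- The simulated view of the parties in `C`, given the outputs of all functionalities and the
shares that the parties output. -/
noncomputable def simView (C : Finset (Fin m)) {κ : ℕ} (x : Fin m → Input)
    (φ : Formula (Literal F m)) (o : LitOut φ κ) (s : Fin m → F κ) :
    PMF (Fin m → List (Val (F κ))) :=
  (simEmulation C φ o).bind fun p => (simTrans C p.1 s).map fun w =>
    restrictViews C fun i => Val.ofBits (x i) :: (p.2 i ++ w i)

/-- The law of the views of a proper subset of the parties, jointly with the outputs of all
parties. -/
theorem protocol_map {C : Finset (Fin m)} (hC : C ≠ Finset.univ) (κ : ℕ) (x : Fin m → Input)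
    (φ : Formula (Literal F m)) :
    (protocol φ κ x).map (fun p => (p.2, restrictViews C p.1)) =
      (litLaw κ x φ).bind fun o => (idealPZS (secret φ o = 0)).bind fun s =>
        (simView C x φ o s).map fun v => (s, v) := by
  have hl : (protocol φ κ x).map (fun p => (p.2, restrictViews C p.1)) =
      ((emulation κ x φ).map
        (fun p => (∑ i, p.1 i, restrictShares C p.1, restrictViews C p.2))).bind fun q =>
      (idealPZS (q.1 = 0)).bind fun s => (simTrans C q.2.1 s).map fun w =>
        (s, restrictViews C fun i => Val.ofBits (x i) :: (q.2.2 i ++ w i)) := by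
    rw [protocol_eq]
    simp only [PMF.bind_map, PMF.map_bind, PMF.pure_map, Function.comp_def,
      simTrans_restrictShares]
    refine congrArg _ (funext fun p => ?_)
    have := congrArg (PMF.map fun t => (t.1, restrictViews C fun i =>
      Val.ofBits (x i) :: (restrictViews C p.2 i ++ t.2 i))) (transformation_map hC p.1)
    simp only [PMF.map_comp, Function.comp_def, PMF.map_bind] at this
    rw [← this, ← PMF.bind_pure_comp]
    refine congrArg _ (funext fun q => congrArg _ (Prod.ext rfl (restrictViews_congr ?_)))
    intro i hi
    simp [restrictViews, hi]
  rw [hl, emulation_map hC]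
  simp only [simView, PMF.map_bind, PMF.bind_map, PMF.bind_bind, Function.comp_def, PMF.map_comp]
  refine congrArg _ (funext fun o => ?_)
  rw [PMF.bind_comm]

/-! ### Correctness -/

theorem map_secret_lit (κ : ℕ) (x : Fin m → Input) (ℓ : Literal F m) :
    (litLaw κ x (.lit ℓ)).map (secret (.lit ℓ)) =
      ((ℓ.func κ fun i => x i).map fun o i => (o i).1).map fun s => ∑ i, s i := by
  rw [PMF.map_comp]; rfl

theorem map_secret_and (κ : ℕ) (x : Fin m → Input) (φ ψ : Formula (Literal F m)) :
    (litLaw κ x (.and φ ψ)).map (secret (.and φ ψ)) =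
      ((litLaw κ x φ).map (secret φ)).bind fun r => ((litLaw κ x ψ).map (secret ψ)).bind fun r' =>
        PMF.pure (r + r') := by
  refine (litLaw_and_bind κ x φ ψ _).trans ?_
  simp only [PMF.bind_map, Function.comp_def]; rfl

theorem map_secret_or (κ : ℕ) (x : Fin m → Input) (φ ψ : Formula (Literal F m)) :
    (litLaw κ x (.or φ ψ)).map (secret (.or φ ψ)) =
      ((litLaw κ x φ).map (secret φ)).bind fun r => ((litLaw κ x ψ).map (secret ψ)).bind fun r' =>
        PMF.pure (r * r') := by
  refine (litLaw_or_bind κ x φ ψ _).trans ?_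
  simp only [PMF.bind_map, Function.comp_def]; rfl

theorem uniform_bind_pure_add {K : Type} [Field K] [Fintype K] (r : K) :
    ((PMF.uniformOfFintype K).bind fun r' => PMF.pure (r + r')) = PMF.uniformOfFintype K :=
  (uniform_bind_bijective (fun r' => r + r') (AddGroup.addLeft_bijective r) PMF.pure).trans
    (PMF.bind_pure _)

/-- If `Q'` holds, the second summand vanishes; otherwise it is an independent uniform mask. -/
theorem idealSecret_bind_add {K : Type} [Field K] [Fintype K] (Q Q' : Prop) :
    ((idealSecret Q).bind fun r => (idealSecret Q').bind fun r' => PMF.pure (r + r')) =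
      (idealSecret (Q ∧ Q') : PMF K) := by
  by_cases h' : Q'
  · rw [idealSecret_true h', show (Q ∧ Q') = Q by simp [h']]
    simp
  · rw [idealSecret_false h', idealSecret_false fun h : Q ∧ Q' => h' h.2]
    simp only [uniform_bind_pure_add, PMF.bind_const]

theorem uniform_apply_toReal {K : Type} [Fintype K] [Nonempty K] (a : K) :
    (PMF.uniformOfFintype K a).toReal = (Fintype.card K : ℝ)⁻¹ := by
  simp

/-- A vanishing factor makes the product exactly zero. If both factors are uniform, multiplication
by a nonzero first factor permutes the field, and the first factor is zero with probability `1/|F|`.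
-/
theorem tvDist_idealSecret_bind_mul {K : Type} [Field K] [Fintype K] (Q Q' : Prop) :
    tvDist ((idealSecret Q).bind fun r => (idealSecret Q').bind fun r' => PMF.pure (r * r'))
      (idealSecret (Q ∨ Q') : PMF K) ≤ (Fintype.card K : ℝ)⁻¹ := by
  by_cases h : Q
  · rw [idealSecret_true (Q := Q ∨ Q') (Or.inl h), idealSecret_true h]
    simp [tvDist_self]
  · by_cases h' : Q'
    · rw [idealSecret_true (Q := Q ∨ Q') (Or.inr h'), idealSecret_true h']
      simp [tvDist_self]
    · rw [idealSecret_false h, idealSecret_false h', idealSecret_false (by tauto)]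
      -- The target is written with a dummy first draw, to compare both laws for each value of the
      -- first factor.
      have h2 : PMF.uniformOfFintype K =
        (PMF.uniformOfFintype K).bind fun _ => PMF.uniformOfFintype K := (PMF.bind_const _ _).symm
      conv_lhs => rw [h2]
      rw [← uniform_apply_toReal (0 : K)]
      simp only [PMF.bind_const]
      conv_lhs => arg 2; rw [h2]
      refine tvDist_bind_right_le_apply _ _ _ 0 fun a ha => ?_
      exact (uniform_bind_bijective (fun r' => a * r') (mulLeft_bijective₀ a ha)
        PMF.pure).trans (PMF.bind_pure _)

/-- The secrets of subformulas come from independent calls, so their errors add up. The gate `∧`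
adds nothing, the gate `∨` adds `1/|F|`. -/
theorem tvDist_secret (κ : ℕ) (x : Fin m → Input) (φ : Formula (Literal F m)) :
    tvDist ((litLaw κ x φ).map (secret φ)) (idealSecret (φ.pred x)) ≤
      (φ.literals.map fun ℓ => ℓ.error κ x).sum + φ.numOr * (Fintype.card (F κ) : ℝ)⁻¹ := by
  induction φ with
  | lit ℓ =>
    rw [map_secret_lit, show idealSecret (Formula.pred (.lit ℓ) x) = _ from
      (idealPZS_map_sum (P := ℓ.parties) (F := F κ) (ℓ.pred fun i => x i)).symm]
    simpa [Formula.literals, Formula.numOr, Literal.error] using tvDist_map_le _ _ _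
  | and φ ψ ihφ ihψ =>
    rw [map_secret_and, show idealSecret (Formula.pred (.and φ ψ) x) = _ from
      (idealSecret_bind_add (K := F κ) (φ.pred x) (ψ.pred x)).symm]
    refine (tvDist_bind₂_le _ _ _ _ _).trans ((add_le_add ihφ ihψ).trans_eq ?_)
    simp only [Formula.literals, Formula.numOr, List.map_append, List.sum_append, Nat.cast_add]
    ring
  | or φ ψ ihφ ihψ =>
    rw [map_secret_or]
    refine (tvDist_triangle _ _ _).trans ((add_le_add ((tvDist_bind₂_le _ _ _ _ _).trans
      (add_le_add ihφ ihψ)) (tvDist_idealSecret_bind_mul (φ.pred x) (ψ.pred x))).trans_eq ?_)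
    simp only [Formula.literals, Formula.numOr, List.map_append, List.sum_append, Nat.cast_add,
      Nat.cast_one]
    ring

theorem mul_inv_card_le {n s c : ℕ} (hc : 0 < c) (h : n * 2 ^ s ≤ c) :
    n * (c : ℝ)⁻¹ ≤ (2 : ℝ)⁻¹ ^ s := by
  rw [inv_pow, ← div_eq_mul_inv, div_le_iff₀ (by exact_mod_cast hc), inv_mul_eq_div,
    le_div_iff₀ (by positivity)]
  exact_mod_cast h

theorem map_const' {α β : Type} (p : PMF α) (b : β) : p.map (fun _ => b) = PMF.pure b :=
  PMF.map_const p b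

theorem emulation_map_sum (κ : ℕ) (x : Fin m → Input) (φ : Formula (Literal F m)) :
    (emulation κ x φ).map (fun p => ∑ i, p.1 i) = (litLaw κ x φ).map (secret φ) := by
  -- With nobody corrupted, only the secret is left of the joint law. The empty set is proper
  -- because there is a party.
  have h := congrArg (PMF.map Prod.fst) (emulation_map (C := ∅)
    Finset.univ_nonempty.ne_empty.symm κ x φ)
  rw [← PMF.bind_pure_comp (secret φ)]
  simpa only [PMF.map_comp, PMF.map_bind, Function.comp_def, map_const'] using h

theorem protocol_map_output (κ : ℕ) (x : Fin m → Input) (φ : Formula (Literal F m)) :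
    (protocol φ κ x).map (fun p => p.2) =
      ((litLaw κ x φ).map (secret φ)).bind fun r => idealPZS (r = 0) := by
  have h := congrArg (PMF.map Prod.fst) (protocol_map (C := ∅)
    Finset.univ_nonempty.ne_empty.symm κ x φ)
  simpa only [PMF.map_comp, PMF.map_bind, PMF.bind_map, Function.comp_def, map_const',
    PMF.bind_pure] using h

/-- If `Q` fails, the two laws agree given any `r ≠ 0`, and the uniform `r` vanishes with
probability `1/|F|`. -/
theorem tvDist_idealSecret_bind_idealPZS {P K : Type} [Fintype P] [DecidableEq P] [Nonempty P]
    [Field K] [Fintype K] (Q : Prop) :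
    tvDist ((idealSecret Q : PMF K).bind fun r => (idealPZS (r = 0) : PMF (P → K)))
      (idealPZS Q) ≤ (Fintype.card K : ℝ)⁻¹ := by
  by_cases h : Q
  · rw [idealSecret_true h, PMF.pure_bind, idealPZS_true h, idealPZS_true rfl, tvDist_self]
    positivity
  · rw [idealSecret_false h, ← PMF.bind_const (PMF.uniformOfFintype K) (idealPZS Q),
      ← uniform_apply_toReal (0 : K)]
    refine tvDist_bind_right_le_apply _ _ _ 0 fun a ha => ?_
    rw [idealPZS_false ha, idealPZS_false h]

theorem tvDist_output (κ : ℕ) (x : Fin m → Input) (φ : Formula (Literal F m)) :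
    tvDist ((protocol φ κ x).map fun p => p.2) (idealPZS (φ.pred x)) ≤
      tvDist ((litLaw κ x φ).map (secret φ)) (idealSecret (φ.pred x)) +
        (Fintype.card (F κ) : ℝ)⁻¹ := by
  rw [protocol_map_output]
  exact (tvDist_triangle _ _ _).trans
    (add_le_add (tvDist_bind_le _ _ _) (tvDist_idealSecret_bind_idealPZS _))

/-- The probability that the truth value indicated by the secret is wrong. -/
theorem secret_wrong_le (κ : ℕ) (x : Fin m → Input) (φ : Formula (Literal F m)) :
    (((litLaw κ x φ).map fun o => ¬(secret φ o = 0 ↔ φ.pred x)) True).toReal ≤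
      tvDist ((litLaw κ x φ).map (secret φ)) (idealSecret (φ.pred x)) +
        (Fintype.card (F κ) : ℝ)⁻¹ := by
  classical
  have h := event_sub_le_tvDist ((litLaw κ x φ).map (secret φ)) (idealSecret (φ.pred x))
    fun r => ¬(r = 0 ↔ φ.pred x)
  rw [PMF.map_comp] at h
  refine le_trans (sub_le_iff_le_add.1 h) (add_le_add le_rfl ?_)
  rw [map_prop_toReal]
  -- An ideal secret is never wrong if the formula holds; otherwise it is wrong only at zero.
  by_cases hQ : φ.pred x
  · rw [idealSecret_true hQ, Finset.sum_eq_zero]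
    · positivity
    · intro a _
      by_cases ha : a = 0 <;> simp [ha, hQ, PMF.pure_apply]
  · rw [idealSecret_false hQ, Finset.sum_eq_single 0] <;> simp +contextual [hQ]

end FormulaSimulation

/-! ### Running single programs -/

section Run

variable {F : Type} [Field F] [Fintype F] {enc : F ↪ List Bool}

theorem run_seq (p q : Prog) (v : Val F) :
    (Prog.seq p q).run enc v = (p.run enc v).bind (q.run enc) := by
  simp only [Prog.run, Prog.exec, PMF.map_bind, PMF.map_comp, PMF.bind_map, Function.comp_def]

theorem run_pair (p q : Prog) (v : Val F) :
    (Prog.pair p q).run enc v =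
      (p.run enc v).bind fun a => (q.run enc v).map fun b => Val.pair a b := by
  simp only [Prog.run, Prog.exec, PMF.map_bind, PMF.map_comp, PMF.bind_map, Function.comp_def]

theorem run_cond_nil (p q : Prog) (w : Val F) :
    (Prog.cond p q).run enc (.pair .nil w) = q.run enc w := by
  simp only [Prog.run, Prog.exec, PMF.map_comp, Function.comp_def]

theorem run_cond_of_ne_nil (p q : Prog) {c : Val F} (hc : c ≠ .nil) (w : Val F) :
    (Prog.cond p q).run enc (.pair c w) = p.run enc w := by
  cases c with
  | nil => exact absurd rfl hc
  | elt x => simp only [Prog.run, Prog.exec, PMF.map_comp, Function.comp_def]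
  | pair a b => simp only [Prog.run, Prog.exec, PMF.map_comp, Function.comp_def]

theorem mem_support_run {p : Prog} {v : Val F} {r : Val F × ℕ}
    (h : r ∈ (p.exec enc v).support) : r.1 ∈ (p.run enc v).support := by
  rw [Prog.run, PMF.support_map]
  exact ⟨r, h, rfl⟩

/-- Time bounds of given programs are promised on well-formed data only, so `q` is bounded just on
the possible results of `p`. -/
theorem costLE_seq {p q : Prog} {v : Val F} {c d : ℕ} (hp : p.CostLE enc v c)
    (hq : ∀ w ∈ (p.run enc v).support, q.CostLE enc w d) :
    (Prog.seq p q).CostLE enc v (c + d + 1) := by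
  intro r hr
  simp only [Prog.exec, PMF.mem_support_bind_iff, PMF.mem_support_map_iff] at hr
  obtain ⟨s, hs, t, ht, rfl⟩ := hr
  have h1 := hp s hs
  have h2 := hq _ (mem_support_run hs) t ht
  dsimp only
  omega

theorem costLE_pair {p q : Prog} {v : Val F} {c d : ℕ} (hp : p.CostLE enc v c)
    (hq : q.CostLE enc v d) : (Prog.pair p q).CostLE enc v (c + d + 1) := by
  intro r hr
  simp only [Prog.exec, PMF.mem_support_bind_iff, PMF.mem_support_map_iff] at hr
  obtain ⟨s, hs, t, ht, rfl⟩ := hr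
  have h1 := hp s hs
  have h2 := hq t ht
  dsimp only
  omega

theorem costLE_cond_nil {p q : Prog} {w : Val F} {c : ℕ} (hq : q.CostLE enc w c) :
    (Prog.cond p q).CostLE enc (.pair .nil w) (c + 1) := by
  intro r hr
  simp only [Prog.exec, PMF.mem_support_map_iff] at hr
  obtain ⟨t, ht, rfl⟩ := hr
  exact Nat.succ_le_succ (hq t ht)

theorem costLE_cond_of_ne_nil {p q : Prog} {w v : Val F} {c : ℕ} (hv : v ≠ .nil)
    (hp : p.CostLE enc w c) : (Prog.cond p q).CostLE enc (.pair v w) (c + 1) := by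
  intro r hr
  cases v with
  | nil => exact absurd rfl hv
  | elt x =>
    simp only [Prog.exec, PMF.mem_support_map_iff] at hr
    obtain ⟨t, ht, rfl⟩ := hr
    exact Nat.succ_le_succ (hp t ht)
  | pair a b =>
    simp only [Prog.exec, PMF.mem_support_map_iff] at hr
    obtain ⟨t, ht, rfl⟩ := hr
    exact Nat.succ_le_succ (hp t ht)

theorem Prog.CostLE.mono {p : Prog} {v : Val F} {c d : ℕ} (h : p.CostLE enc v c) (hcd : c ≤ d) :
    p.CostLE enc v d := fun r hr => (h r hr).trans hcd

end Run

/-- Independent samples of two laws. -/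
noncomputable def prodLaw {α β : Type} (X : PMF α) (Y : PMF β) : PMF (α × β) :=
  X.bind fun x => Y.map fun y => (x, y)

theorem prodLaw_bind {α β γ : Type} (X : PMF α) (Y : PMF β) (k : α × β → PMF γ) :
    (prodLaw X Y).bind k = X.bind fun x => Y.bind fun y => k (x, y) := by
  simp only [prodLaw, PMF.bind_bind, PMF.bind_map, Function.comp_def]

theorem prodLaw_map {α β γ : Type} (X : PMF α) (Y : PMF β) (f : α × β → γ) :
    (prodLaw X Y).map f = X.bind fun x => Y.map fun y => f (x, y) := by
  simp only [prodLaw, PMF.map_bind, PMF.map_comp, Function.comp_def]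

theorem mem_support_prodLaw {α β : Type} {X : PMF α} {Y : PMF β} {p : α × β}
    (h : p ∈ (prodLaw X Y).support) : p.1 ∈ X.support ∧ p.2 ∈ Y.support := by
  simp only [prodLaw, PMF.mem_support_bind_iff, PMF.mem_support_map_iff] at h
  obtain ⟨x, hx, y, hy, rfl⟩ := h
  exact ⟨hx, hy⟩

/-! ### Programs of constant cost -/

section ConstantCost

variable {F : ℕ → Type} [∀ κ, Field (F κ)] [∀ κ, Fintype (F κ)] (enc : ∀ κ, F κ ↪ List Bool)
  {ι : Type}

/-- Some program that halts within a constant number of steps on all inputs maps the encoding `e a`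
of every `a` to a random datum with law `f a`. -/
def ConstCost (k : ι → ℕ) (e : ∀ a, Val (F (k a))) (f : ∀ a, PMF (Val (F (k a)))) : Prop :=
  ∃ (p : Prog) (c : ℕ), (∀ κ v, p.CostLE (enc κ) v c) ∧ ∀ a, p.run (enc (k a)) (e a) = f a

/-- Some deterministic program of constant cost maps `e a` to `f a`. -/
def Det (k : ι → ℕ) (e f : ∀ a, Val (F (k a))) : Prop :=
  ConstCost enc k e fun a => PMF.pure (f a)

variable {enc} {k : ι → ℕ} {e : ∀ a, Val (F (k a))}

theorem ConstCost.congr {f f' : ∀ a, PMF (Val (F (k a)))} (h : ConstCost enc k e f)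
    (hf : ∀ a, f a = f' a) : ConstCost enc k e f' := by
  rwa [← funext hf]

theorem Det.congr {f f' : ∀ a, Val (F (k a))} (h : Det enc k e f) (hf : ∀ a, f a = f' a) :
    Det enc k e f' := by
  rwa [← funext hf]

theorem ConstCost.reindex {f : ∀ a, PMF (Val (F (k a)))} (h : ConstCost enc k e f) {ι' : Type}
    (g : ι' → ι) : ConstCost enc (fun a => k (g a)) (fun a => e (g a)) fun a => f (g a) := by
  obtain ⟨p, c, hc, hp⟩ := h
  exact ⟨p, c, hc, fun a => hp (g a)⟩

theorem Det.reindex {f : ∀ a, Val (F (k a))} (h : Det enc k e f) {ι' : Type}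
    (g : ι' → ι) : Det enc (fun a => k (g a)) (fun a => e (g a)) fun a => f (g a) :=
  ConstCost.reindex h g

/-- First sample `X`, then run a program on the result. -/
theorem ConstCost.andThen {β : ι → Type} {X : ∀ a, PMF (β a)} {e' : ∀ a, β a → Val (F (k a))}
    {g : ∀ a, β a → PMF (Val (F (k a)))}
    (h : ConstCost enc k e fun a => (X a).map (e' a))
    (hg : ConstCost enc (ι := {p : Σ a, β a // p.2 ∈ (X p.1).support}) (fun p => k p.1.1)
      (fun p => e' p.1.1 p.1.2) fun p => g p.1.1 p.1.2) :
    ConstCost enc k e fun a => (X a).bind (g a) := by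
  obtain ⟨p, c, hc, hp⟩ := h
  obtain ⟨q, d, hd, hq⟩ := hg
  refine ⟨.seq p q, c + d + 1, fun κ v => costLE_seq (hc κ v) fun w _ => hd κ w, fun a => ?_⟩
  rw [run_seq, hp, PMF.bind_map]
  ext v
  simp only [PMF.bind_apply, Function.comp]
  refine tsum_congr fun b => ?_
  -- Off the support the weight is zero. The restriction is needed later, because the lengths of
  -- lists are known for possible samples only.
  by_cases hb : b ∈ (X a).support
  · rw [hq ⟨⟨a, b⟩, hb⟩]
  · rw [(PMF.apply_eq_zero_iff _ _).2 hb, zero_mul, zero_mul]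

theorem ConstCost.map {β : ι → Type} {X : ∀ a, PMF (β a)} {e' : ∀ a, β a → Val (F (k a))}
    {g : ∀ a, β a → Val (F (k a))} (h : ConstCost enc k e fun a => (X a).map (e' a))
    (hg : Det enc (ι := {p : Σ a, β a // p.2 ∈ (X p.1).support}) (fun p => k p.1.1)
      (fun p => e' p.1.1 p.1.2) fun p => g p.1.1 p.1.2) :
    ConstCost enc k e fun a => (X a).map (g a) :=
  ConstCost.andThen (g := fun a b => PMF.pure (g a b)) h hg

theorem Det.comp {f : ∀ a, Val (F (k a))} {g : ∀ a, PMF (Val (F (k a)))} (hf : Det enc k e f)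
    (hg : ConstCost enc k f g) : ConstCost enc k e g := by
  obtain ⟨p, c, hc, hp⟩ := hf
  obtain ⟨q, d, hd, hq⟩ := hg
  refine ⟨.seq p q, c + d + 1, fun κ v => costLE_seq (hc κ v) fun w _ => hd κ w, fun a => ?_⟩
  rw [run_seq, hp, PMF.pure_bind, hq]

theorem ConstCost.pair {f g : ∀ a, PMF (Val (F (k a)))} (hf : ConstCost enc k e f)
    (hg : ConstCost enc k e g) :
    ConstCost enc k e fun a => (f a).bind fun x => (g a).map fun y => Val.pair x y := by
  obtain ⟨p, c, hc, hp⟩ := hf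
  obtain ⟨q, d, hd, hq⟩ := hg
  refine ⟨.pair p q, c + d + 1, fun κ v => costLE_pair (hc κ v) (hd κ v), fun a => ?_⟩
  rw [run_pair, hp, hq]

theorem ConstCost.prod {β γ : ι → Type} {X : ∀ a, PMF (β a)} {Y : ∀ a, PMF (γ a)}
    {e' : ∀ a, β a → Val (F (k a))} {e'' : ∀ a, γ a → Val (F (k a))}
    (hX : ConstCost enc k e fun a => (X a).map (e' a))
    (hY : ConstCost enc k e fun a => (Y a).map (e'' a)) :
    ConstCost enc k e fun a => (prodLaw (X a) (Y a)).map fun p => .pair (e' a p.1) (e'' a p.2) :=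
  (hX.pair hY).congr fun a => by
    simp only [prodLaw_map, PMF.bind_map, PMF.map_comp, Function.comp_def]

theorem Det.pair {f g : ∀ a, Val (F (k a))} (hf : Det enc k e f) (hg : Det enc k e g) :
    Det enc k e fun a => .pair (f a) (g a) :=
  (ConstCost.pair hf hg).congr fun a => by rw [PMF.pure_bind, PMF.pure_map]

/-- Atomic operations. -/
theorem Det.of_prog {p : Prog} {f : ∀ κ, Val (F κ) → Val (F κ)} {g : ∀ a, Val (F (k a))}
    (hg : Det enc k e g) (hp : ∀ κ v, p.exec (enc κ) v = PMF.pure (f κ v, 1)) :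
    Det enc k e fun a => f (k a) (g a) := by
  refine hg.comp ⟨p, 1, fun κ v r hr => ?_, fun a => ?_⟩
  · rw [hp, PMF.support_pure, Set.mem_singleton_iff] at hr
    rw [hr]
  · rw [Prog.run, hp, PMF.pure_map]

theorem Det.self : Det enc k e e := by
  refine ⟨.skip, 1, fun κ v r hr => ?_, fun a => ?_⟩
  · rw [Prog.exec, PMF.support_pure, Set.mem_singleton_iff] at hr
    rw [hr]
  · rw [Prog.run, Prog.exec, PMF.pure_map]

theorem Det.head {f : ∀ a, Val (F (k a))} (hf : Det enc k e f) :
    Det enc k e fun a => (f a).head :=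
  hf.of_prog (p := .head) (f := fun _ => Val.head) fun _ _ => rfl

theorem Det.tail {f : ∀ a, Val (F (k a))} (hf : Det enc k e f) :
    Det enc k e fun a => (f a).tail :=
  hf.of_prog (p := .tail) (f := fun _ => Val.tail) fun _ _ => rfl

theorem Det.fst {f g : ∀ a, Val (F (k a))} (hf : Det enc k e fun a => .pair (f a) (g a)) :
    Det enc k e f := hf.head

theorem Det.snd {f g : ∀ a, Val (F (k a))} (hf : Det enc k e fun a => .pair (f a) (g a)) :
    Det enc k e g := hf.tail

theorem Det.nil : Det enc k e fun _ => .nil :=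
  Det.self.of_prog (p := .nil) (f := fun _ _ => Val.nil) fun _ _ => rfl

theorem Det.one : Det enc k e fun _ => .elt 1 :=
  Det.self.of_prog (p := .one) (f := fun _ _ => Val.elt 1) fun _ _ => rfl

theorem Det.add {f g : ∀ a, F (k a)} (hf : Det enc k e fun a => .elt (f a))
    (hg : Det enc k e fun a => .elt (g a)) : Det enc k e fun a => .elt (f a + g a) :=
  (hf.pair hg).of_prog (p := .add) (f := fun _ => Val.binop (· + ·)) fun _ _ => rfl

theorem Det.mul {f g : ∀ a, F (k a)} (hf : Det enc k e fun a => .elt (f a))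
    (hg : Det enc k e fun a => .elt (g a)) : Det enc k e fun a => .elt (f a * g a) :=
  (hf.pair hg).of_prog (p := .mul) (f := fun _ => Val.binop (· * ·)) fun _ _ => rfl

theorem Det.neg {f : ∀ a, F (k a)} (hf : Det enc k e fun a => .elt (f a)) :
    Det enc k e fun a => .elt (-f a) :=
  hf.of_prog (p := .neg) (f := fun _ => Val.unop (- ·)) fun _ _ => rfl

theorem Det.sub {f g : ∀ a, F (k a)} (hf : Det enc k e fun a => .elt (f a))
    (hg : Det enc k e fun a => .elt (g a)) : Det enc k e fun a => .elt (f a - g a) :=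
  (hf.add hg.neg).congr fun a => by rw [sub_eq_add_neg]

theorem Det.zero : Det enc k e fun _ => .elt 0 :=
  (Det.one.sub Det.one).congr fun a => by rw [sub_self]

/-- The sum is unrolled into one addition per element. The cost is constant because `s` does not
depend on `a`. -/
theorem Det.sum {P : Type} (s : Finset P) {f : ∀ a, P → F (k a)}
    (hf : ∀ i ∈ s, Det enc k e fun a => .elt (f a i)) :
    Det enc k e fun a => .elt (∑ i ∈ s, f a i) := by
  classical
  induction s using Finset.induction_on with
  | empty => simpa using Det.zero
  | insert i s hi ih =>
    simp only [Finset.sum_insert hi]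
    exact (hf i (Finset.mem_insert_self i s)).add
      (ih fun j hj => hf j (Finset.mem_insert_of_mem hj))

theorem Det.ofList_map {P : Type} (l : List P) {w : ∀ a, P → Val (F (k a))}
    (hw : ∀ i ∈ l, Det enc k e fun a => w a i) :
    Det enc k e fun a => .ofList (l.map (w a)) := by
  induction l with
  | nil => exact Det.nil
  | cons i l ih =>
    exact (hw i List.mem_cons_self).pair (ih fun j hj => hw j (List.mem_cons_of_mem i hj))

theorem Det.get {P : Type} {l : List P} {w : ∀ a, P → Val (F (k a))}
    (h : Det enc k e fun a => .ofList (l.map (w a))) {i : P} (hi : i ∈ l) :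
    Det enc k e fun a => w a i := by
  induction l with
  | nil => simp at hi
  | cons j l ih =>
    rcases List.mem_cons.1 hi with rfl | hi
    · exact h.fst
    · exact ih h.snd hi

theorem Det.cons {f : ∀ a, Val (F (k a))} {l : ∀ a, List (Val (F (k a)))} (hf : Det enc k e f)
    (hl : Det enc k e fun a => .ofList (l a)) : Det enc k e fun a => .ofList (f a :: l a) :=
  hf.pair hl

/-- Lists of a fixed length can be concatenated. -/
theorem Det.append {n : ℕ} {l l' : ∀ a, List (Val (F (k a)))} (hn : ∀ a, (l a).length = n)
    (hl : Det enc k e fun a => .ofList (l a)) (hl' : Det enc k e fun a => .ofList (l' a)) :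
    Det enc k e fun a => .ofList (l a ++ l' a) := by
  induction n generalizing l with
  | zero => exact hl'.congr fun a => by rw [List.length_eq_zero_iff.1 (hn a), List.nil_append]
  | succ n ih =>
    have h : ∀ a, ∃ x t, l a = x :: t := fun a => List.exists_cons_of_length_eq_add_one (hn a)
    choose x t hxt using h
    simp only [hxt, List.length_cons, Nat.add_right_cancel_iff, List.cons_append] at hn hl ⊢
    exact Det.cons hl.fst (ih hn hl.snd)

theorem Det.restrictTo {P : Type} [Fintype P] [LinearOrder P] (C : Finset P)
    {w : ∀ a, P → Val (F (k a))} (hw : ∀ i ∈ C, Det enc k e fun a => w a i) :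
    Det enc k e fun a => restrictTo C (w a) := by
  refine Det.ofList_map _ fun i _ => ?_
  by_cases hi : i ∈ C
  · simp only [hi, if_true]
    exact (hw i hi).pair Det.nil
  · simp only [hi, if_false]
    exact Det.nil

theorem Det.entry {P : Type} [Fintype P] [LinearOrder P] {C : ι → Finset P}
    {w : ∀ a, P → Val (F (k a))} (h : Det enc k e fun a => PZS.restrictTo (C a) (w a)) (i : P) :
    Det enc k e fun a => Val.ofOption (if i ∈ C a then some (w a i) else none) :=
  Det.get h ((Finset.mem_sort _).2 (Finset.mem_univ i))

theorem Det.of_restrictTo {P : Type} [Fintype P] [LinearOrder P] {C : Finset P}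
    {w : ∀ a, P → Val (F (k a))} (h : Det enc k e fun a => PZS.restrictTo C (w a)) {i : P}
    (hi : i ∈ C) : Det enc k e fun a => w a i := by
  have := Det.entry (C := fun _ => C) h i
  simp only [hi, if_true] at this
  exact this.fst

theorem Det.of_sharesVal {P : Type} [Fintype P] [LinearOrder P] {s : ∀ a, P → F (k a)}
    (h : Det enc k e fun a => sharesVal (s a)) (i : P) : Det enc k e fun a => .elt (s a i) :=
  Det.of_restrictTo h (Finset.mem_univ i)

theorem ConstCost.unif : ConstCost enc k e fun a =>
    (PMF.uniformOfFintype (F (k a))).map fun x => .elt x := by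
  refine ⟨.unif, 1, fun κ v r hr => ?_, fun a => ?_⟩
  · rw [Prog.exec, PMF.mem_support_map_iff] at hr
    obtain ⟨x, _, rfl⟩ := hr
    exact le_rfl
  · rw [Prog.run, Prog.exec, PMF.map_comp]
    rfl

/-- The coordinates are drawn one by one, by induction on a list of parties without repetitions;
`uniform_update` splits off the first. -/
theorem ConstCost.uniform_shares {P : Type} [Fintype P] [LinearOrder P] :
    ConstCost enc k e fun a => (PMF.uniformOfFintype (P → F (k a))).map sharesVal := by
  have key : ∀ l : List P, l.Nodup → ConstCost enc k e fun a =>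
      (PMF.uniformOfFintype (P → F (k a))).map fun s =>
        Val.ofList (l.map fun i => Val.pair (.elt (s i)) .nil) := by
    intro l hl
    induction l with
    | nil => exact ConstCost.congr Det.nil fun a => (map_const' _ _).symm
    | cons i l ih =>
      rw [List.nodup_cons] at hl
      have h1 : ConstCost enc k e fun a =>
          (PMF.uniformOfFintype (F (k a))).map fun x => .pair (.elt x) .nil :=
        ConstCost.map (β := fun a => F (k a)) ConstCost.unif (by
          refine Det.pair ?_ Det.nil
          exact Det.self)
      refine (h1.prod (ih hl.2)).congr fun a => ?_
      simp only [prodLaw_map]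
      rw [← PMF.bind_pure_comp, uniform_update i]
      refine congrArg _ (funext fun x => ?_)
      rw [← PMF.bind_pure_comp]
      refine congrArg _ (funext fun s => ?_)
      have h2 : l.map (fun j => Val.pair (.elt (Function.update s i x j)) .nil) =
          l.map fun j => Val.pair (.elt (s j)) .nil := List.map_congr_left fun j hj => by
        rw [Function.update_of_ne (fun h : j = i => hl.1 (h ▸ hj))]
      simp only [Function.comp, List.map_cons, Function.update_self, Val.ofList, h2]
  refine (key _ (Finset.sort_nodup (Finset.univ : Finset P) (· ≤ ·))).congr fun a => ?_
  refine congrArg (fun f => PMF.map f _) (funext fun s => ?_)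
  simp only [sharesVal, PZS.restrictTo, Finset.mem_univ, if_true]
  rfl

end ConstantCost

/-! ### Programs of polynomial cost -/

section PolynomialCost

theorem eval_mono_nat (T : Polynomial ℕ) {a b : ℕ} (h : a ≤ b) : T.eval a ≤ T.eval b := by
  simp only [Polynomial.eval_eq_sum, Polynomial.sum]
  exact Finset.sum_le_sum fun i _ => Nat.mul_le_mul_left _ (Nat.pow_le_pow_left h i)

variable {F : ℕ → Type} [∀ κ, Field (F κ)] [∀ κ, Fintype (F κ)] (enc : ∀ κ, F κ ↪ List Bool)
  {ι : Type}

/-- Some program maps the encoding `e a` of every `a` to a random datum with law `f a`, in a number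
of steps that is polynomial in the size `n a`. -/
def PolyCost (k : ι → ℕ) (e : ∀ a, Val (F (k a))) (n : ι → ℕ) (f : ∀ a, PMF (Val (F (k a)))) :
    Prop :=
  ∃ (p : Prog) (T : Polynomial ℕ),
    ∀ a, p.CostLE (enc (k a)) (e a) (T.eval (n a)) ∧ p.run (enc (k a)) (e a) = f a

variable {enc} {k : ι → ℕ} {e : ∀ a, Val (F (k a))} {n : ι → ℕ}

theorem PolyCost.congr {f f' : ∀ a, PMF (Val (F (k a)))} (h : PolyCost enc k e n f)
    (hf : ∀ a, f a = f' a) : PolyCost enc k e n f' := by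
  rwa [← funext hf]

theorem PolyCost.mono {n' : ι → ℕ} {f : ∀ a, PMF (Val (F (k a)))} (h : PolyCost enc k e n f)
    (hn : ∀ a, n a ≤ n' a) : PolyCost enc k e n' f := by
  obtain ⟨p, T, h⟩ := h
  exact ⟨p, T, fun a => ⟨(h a).1.mono (eval_mono_nat T (hn a)), (h a).2⟩⟩

theorem PolyCost.reindex {f : ∀ a, PMF (Val (F (k a)))} (h : PolyCost enc k e n f) {ι' : Type}
    (g : ι' → ι) : PolyCost enc (fun a => k (g a)) (fun a => e (g a)) (fun a => n (g a))
      fun a => f (g a) := by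
  obtain ⟨p, T, h⟩ := h
  exact ⟨p, T, fun a => h (g a)⟩

theorem ConstCost.polyCost {f : ∀ a, PMF (Val (F (k a)))} (h : ConstCost enc k e f) :
    PolyCost enc k e n f := by
  obtain ⟨p, c, hc, hp⟩ := h
  exact ⟨p, Polynomial.C c, fun a => ⟨by rw [Polynomial.eval_C]; exact hc _ _, hp a⟩⟩

theorem PolyCost.andThen {β : ι → Type} {X : ∀ a, PMF (β a)} {e' : ∀ a, β a → Val (F (k a))}
    {g : ∀ a, β a → PMF (Val (F (k a)))}
    (h : PolyCost enc k e n fun a => (X a).map (e' a))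
    (hg : PolyCost enc (ι := {p : Σ a, β a // p.2 ∈ (X p.1).support}) (fun p => k p.1.1)
      (fun p => e' p.1.1 p.1.2) (fun p => n p.1.1) fun p => g p.1.1 p.1.2) :
    PolyCost enc k e n fun a => (X a).bind (g a) := by
  obtain ⟨p, T, hp⟩ := h
  obtain ⟨q, U, hq⟩ := hg
  refine ⟨.seq p q, T + U + 1, fun a => ⟨?_, ?_⟩⟩
  · rw [Polynomial.eval_add, Polynomial.eval_add, Polynomial.eval_one]
    refine costLE_seq (hp a).1 fun w hw => ?_
    rw [(hp a).2, PMF.mem_support_map_iff] at hw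
    obtain ⟨b, hb, rfl⟩ := hw
    exact (hq ⟨⟨a, b⟩, hb⟩).1
  · rw [run_seq, (hp a).2, PMF.bind_map]
    ext v
    simp only [PMF.bind_apply, Function.comp]
    refine tsum_congr fun b => ?_
    by_cases hb : b ∈ (X a).support
    · rw [(hq ⟨⟨a, b⟩, hb⟩).2]
    · rw [(PMF.apply_eq_zero_iff _ _).2 hb, zero_mul, zero_mul]

theorem Det.comp_polyCost {f : ∀ a, Val (F (k a))} {g : ∀ a, PMF (Val (F (k a)))}
    (hf : Det enc k e f) (hg : PolyCost enc k f n g) : PolyCost enc k e n g := by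
  obtain ⟨p, c, hc, hp⟩ := hf
  obtain ⟨q, U, hq⟩ := hg
  refine ⟨.seq p q, Polynomial.C c + U + 1, fun a => ⟨?_, ?_⟩⟩
  · rw [Polynomial.eval_add, Polynomial.eval_add, Polynomial.eval_one, Polynomial.eval_C]
    refine costLE_seq (hc _ _) fun w hw => ?_
    rw [hp, PMF.support_pure, Set.mem_singleton_iff] at hw
    rw [hw]
    exact (hq a).1
  · rw [run_seq, hp, PMF.pure_bind, (hq a).2]

theorem PolyCost.pair {f g : ∀ a, PMF (Val (F (k a)))} (hf : PolyCost enc k e n f)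
    (hg : PolyCost enc k e n g) :
    PolyCost enc k e n fun a => (f a).bind fun x => (g a).map fun y => Val.pair x y := by
  obtain ⟨p, T, hp⟩ := hf
  obtain ⟨q, U, hq⟩ := hg
  refine ⟨.pair p q, T + U + 1, fun a => ⟨?_, ?_⟩⟩
  · rw [Polynomial.eval_add, Polynomial.eval_add, Polynomial.eval_one]
    exact costLE_pair (hp a).1 (hq a).1
  · rw [run_pair, (hp a).2, (hq a).2]

/-- Case distinction on whether the datum `c a` is empty. -/
theorem PolyCost.cond {c : ∀ a, Val (F (k a))} {f : ∀ a, PMF (Val (F (k a)))}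
    (hc : Det enc k e c)
    (h1 : PolyCost enc (ι := {a // c a ≠ .nil}) (fun a => k a) (fun a => e a) (fun a => n a)
      fun a => f a)
    (h2 : PolyCost enc (ι := {a // c a = .nil}) (fun a => k a) (fun a => e a) (fun a => n a)
      fun a => f a) : PolyCost enc k e n f := by
  obtain ⟨p, T, hp⟩ := h1
  obtain ⟨q, U, hq⟩ := h2
  refine (hc.pair Det.self).comp_polyCost ⟨.cond p q, T + U + 1, fun a => ?_⟩
  rw [Polynomial.eval_add, Polynomial.eval_add, Polynomial.eval_one]
  by_cases h : c a = .nil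
  · simp only [h]
    exact ⟨(costLE_cond_nil (hq ⟨a, h⟩).1).mono (by dsimp only; omega),
      (run_cond_nil _ _ _).trans (hq ⟨a, h⟩).2⟩
  · exact ⟨(costLE_cond_of_ne_nil h (hp ⟨a, h⟩).1).mono (by dsimp only; omega),
      (run_cond_of_ne_nil _ _ h _).trans (hp ⟨a, h⟩).2⟩

/-- Case distinction over a set of parties that can be read off the input. -/
theorem PolyCost.cases_finset {P : Type} [Fintype P] [DecidableEq P] {C : ι → Finset P}
    {f : ∀ a, PMF (Val (F (k a)))}
    (hC : ∀ i, ∃ c : ∀ a, Val (F (k a)), Det enc k e c ∧ ∀ a, c a ≠ .nil ↔ i ∈ C a)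
    (h : ∀ D : Finset P, PolyCost enc (ι := {a // C a = D}) (fun a => k a) (fun a => e a)
      (fun a => n a) fun a => f a) : PolyCost enc k e n f := by
  -- A decision tree: `H` records the outcomes of the tests made so far, and `l` lists the parties
  -- still to be tested. Only the part of `D` inside `l` matters, so each branch may insert or erase
  -- the tested party.
  have key : ∀ (l : List P) (H : ι → Prop), (∀ D : Finset P,
      PolyCost enc (ι := {a // H a ∧ ∀ i ∈ l, i ∈ C a ↔ i ∈ D}) (fun a => k a) (fun a => e a)
        (fun a => n a) fun a => f a) →
      PolyCost enc (ι := {a // H a}) (fun a => k a) (fun a => e a) (fun a => n a)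
        fun a => f a := by
    intro l
    induction l with
    | nil => exact fun H hH => (hH ∅).reindex fun a : {a // H a} => ⟨a.1, a.2, by simp⟩
    | cons i l ih =>
      intro H hH
      obtain ⟨c, hc, hci⟩ := hC i
      refine PolyCost.cond (hc.reindex fun a : {a // H a} => a.1) ?_ ?_
      · refine (ih (fun a => H a ∧ i ∈ C a) fun D => ?_).reindex
          fun a : {a : {a // H a} // c a ≠ .nil} => ⟨a.1.1, a.1.2, (hci _).1 a.2⟩
        refine (hH (insert i D)).reindex
          fun a : {a // (H a ∧ i ∈ C a) ∧ ∀ j ∈ l, j ∈ C a ↔ j ∈ D} => ⟨a.1, a.2.1.1, ?_⟩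
        intro j hj
        by_cases hji : j = i
        · subst hji; simpa using a.2.1.2
        · rw [a.2.2 j (List.mem_of_ne_of_mem hji hj)]; simp [hji]
      · refine (ih (fun a => H a ∧ i ∉ C a) fun D => ?_).reindex
          fun a : {a : {a // H a} // c a = .nil} =>
            ⟨a.1.1, a.1.2, fun h => (hci _).2 h a.2⟩
        refine (hH (D.erase i)).reindex
          fun a : {a // (H a ∧ i ∉ C a) ∧ ∀ j ∈ l, j ∈ C a ↔ j ∈ D} => ⟨a.1, a.2.1.1, ?_⟩
        intro j hj
        by_cases hji : j = i
        · subst hji; simpa using a.2.1.2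
        · rw [a.2.2 j (List.mem_of_ne_of_mem hji hj)]; simp [hji]
  refine (key Finset.univ.toList (fun _ => True) fun D => (h D).reindex
    fun a : {a // True ∧ ∀ i ∈ Finset.univ.toList, i ∈ C a ↔ i ∈ D} =>
      ⟨a.1, ?_⟩).reindex fun a => ⟨a, trivial⟩
  ext i
  exact a.2.2 i (by simp)

end PolynomialCost

/-! ### A program that assembles the views -/

section ViewProgram

variable {m : ℕ} [NeZero m] {F : ℕ → Type} [∀ κ, Field (F κ)] [∀ κ, Fintype (F κ)]

/-- The parties of a literal that lie in `C`. -/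
def Literal.inside (ℓ : Literal F m) (C : Finset (Fin m)) : Finset ℓ.parties :=
  C.subtype (· ∈ ℓ.parties)

theorem Literal.mem_inside {ℓ : Literal F m} {C : Finset (Fin m)} {i : ℓ.parties} :
    i ∈ ℓ.inside C ↔ (i : Fin m) ∈ C := Finset.mem_subtype

/-- What the parties in `C` receive from the functionalities. -/
def encodeLitOut (C : Finset (Fin m)) {κ : ℕ} :
    (φ : Formula (Literal F m)) → LitOut φ κ → Val (F κ)
  | .lit ℓ, o => restrictTo (ℓ.inside C) fun i => .pair (.elt (o i).1) (o i).2
  | .and φ ψ, o => .pair (encodeLitOut C φ o.1) (encodeLitOut C ψ o.2)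
  | .or φ ψ, o => .pair (encodeLitOut C φ o.1) (encodeLitOut C ψ o.2)

/-- The shares and the views of the parties in `C`. -/
def encodeState {K : Type} (C : Finset (Fin m)) (p : (Fin m → K) × (Fin m → List (Val K))) :
    Val K :=
  .pair (restrictTo C fun i => .elt (p.1 i)) (restrictTo C fun i => .ofList (p.2 i))

/-- The number of messages that a party receives when a value is opened. -/
def openingLength (i : Fin m) : ℕ :=
  if i = 0 then ((List.finRange m).filter (· ≠ 0)).length else 1

theorem length_opening {K : Type} [Field K] (w : Fin m → K) (i : Fin m) :
    (opening w i).length = openingLength i := by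
  unfold opening openingLength
  split_ifs <;> simp

/-- The number of messages that a party receives in the sharing and emulation stages. -/
def emulationLength (i : Fin m) : Formula (Literal F m) → ℕ
  | .lit ℓ => if i ∈ ℓ.parties then 2 else 0
  | .and φ ψ => emulationLength i φ + emulationLength i ψ
  | .or φ ψ => emulationLength i φ + emulationLength i ψ +
      (3 + openingLength i + openingLength i)

/-- All randomness is moved to the front, as a product law followed by a deterministic map. This is
the form to which `ConstCost.map` applies. -/
theorem simEmulation_and (C : Finset (Fin m)) {κ : ℕ} (φ ψ : Formula (Literal F m))
    (o : LitOut (.and φ ψ) κ) : simEmulation C (.and φ ψ) o =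
      (prodLaw (simEmulation C φ o.1) (simEmulation C ψ o.2)).map fun q =>
        (fun i => q.1.1 i + q.2.1 i, fun i => q.1.2 i ++ q.2.2 i) := by
  rw [prodLaw_map]; rfl

theorem simEmulation_or (C : Finset (Fin m)) {κ : ℕ} (φ ψ : Formula (Literal F m))
    (o : LitOut (.or φ ψ) κ) : simEmulation C (.or φ ψ) o =
      (prodLaw (prodLaw (simEmulation C φ o.1) (simEmulation C ψ o.2))
        (prodLaw (PMF.uniformOfFintype (Fin m → F κ)) (prodLaw (PMF.uniformOfFintype (Fin m → F κ))
          (PMF.uniformOfFintype (Fin m → F κ))))).map fun q =>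
        ((mulResult C q.1.1.1 q.1.2.1 q.2.1 q.2.2.1 q.2.2.2).1, fun i =>
          q.1.1.2 i ++ q.1.2.2 i ++ (mulResult C q.1.1.1 q.1.2.1 q.2.1 q.2.2.1 q.2.2.2).2 i) := by
  simp only [simEmulation, simMul, ← PMF.bind_pure_comp, prodLaw_bind, PMF.bind_bind,
    PMF.pure_bind, Function.comp_def]

/-- Every message count is fixed by the party and the formula. Programs of constant cost can
therefore concatenate views (`Det.append`). -/
theorem length_simEmulation (C : Finset (Fin m)) {κ : ℕ} (φ : Formula (Literal F m))
    (o : LitOut φ κ) {p : (Fin m → F κ) × (Fin m → List (Val (F κ)))}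
    (hp : p ∈ (simEmulation C φ o).support) {i : Fin m} (hi : i ∈ C) :
    (p.2 i).length = emulationLength i φ := by
  induction φ generalizing p with
  | lit ℓ =>
    rw [simEmulation, PMF.support_pure, Set.mem_singleton_iff] at hp
    subst hp
    by_cases h : i ∈ ℓ.parties <;> simp [restrictViews, hi, h, emulationLength]
  | and φ ψ ihφ ihψ =>
    rw [simEmulation_and, PMF.mem_support_map_iff] at hp
    obtain ⟨q, hq, rfl⟩ := hp
    have h := mem_support_prodLaw hq
    simp only [List.length_append, emulationLength, ihφ _ h.1, ihψ _ h.2]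
  | or φ ψ ihφ ihψ =>
    rw [simEmulation_or, PMF.mem_support_map_iff] at hp
    obtain ⟨q, hq, rfl⟩ := hp
    have h := mem_support_prodLaw (mem_support_prodLaw hq).1
    simp only [List.length_append, emulationLength, ihφ _ h.1, ihψ _ h.2, mulResult, restrictViews,
      hi, if_true, length_opening, List.length_cons, List.length_nil]

variable {enc : ∀ κ, F κ ↪ List Bool} {ι : Type} {k : ι → ℕ} {e : ∀ a, Val (F (k a))}

/-- Names the fact that the whole input is available, so that its components can be read off by
projections. -/
theorem Det.intro {f : ∀ a, Val (F (k a))} (h : Det enc k e e → Det enc k e f) : Det enc k e f :=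
  h Det.self

theorem Det.opening {w : ∀ a, Fin m → F (k a)} (hw : ∀ j, Det enc k e fun a => .elt (w a j))
    (i : Fin m) : Det enc k e fun a => .ofList (PZS.opening (w a) i) := by
  unfold PZS.opening
  by_cases h : i = 0
  · simp only [h, if_true]
    exact Det.ofList_map _ fun j _ => hw j
  · simp only [h, if_false]
    exact Det.cons (Det.sum _ fun j _ => hw j) Det.nil

theorem Det.maskSub {C : Finset (Fin m)} {r b : ∀ a, Fin m → F (k a)}
    (hr : ∀ i ∈ C, Det enc k e fun a => .elt (r a i)) (hb : ∀ i, Det enc k e fun a => .elt (b a i))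
    (j : Fin m) : Det enc k e fun a => .elt (PZS.maskSub C (r a) (b a) j) := by
  by_cases h : j ∈ C
  · simp only [PZS.maskSub, h, if_true]
    exact (hr j h).sub (hb j)
  · simp only [PZS.maskSub, h, if_false]
    exact hb j

theorem Det.maskAdd {C : Finset (Fin m)} {r b : ∀ a, Fin m → F (k a)}
    (hr : ∀ i ∈ C, Det enc k e fun a => .elt (r a i)) (hb : ∀ i, Det enc k e fun a => .elt (b a i))
    (j : Fin m) : Det enc k e fun a => .elt (PZS.maskAdd C (r a) (b a) j) := by
  by_cases h : j ∈ C
  · simp only [PZS.maskAdd, h, if_true]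
    exact (hr j h).add (hb j)
  · simp only [PZS.maskAdd, h, if_false]
    exact hb j

theorem Det.mulShares {C : Finset (Fin m)} {r r' b b' c : ∀ a, Fin m → F (k a)}
    (hr : ∀ i ∈ C, Det enc k e fun a => .elt (r a i))
    (hr' : ∀ i ∈ C, Det enc k e fun a => .elt (r' a i))
    (hb : ∀ i, Det enc k e fun a => .elt (b a i)) (hb' : ∀ i, Det enc k e fun a => .elt (b' a i))
    (hc : ∀ i, Det enc k e fun a => .elt (c a i)) {i : Fin m} (hi : i ∈ C) :
    Det enc k e fun a => .elt ((mulResult C (r a) (r' a) (b a) (b' a) (c a)).1 i) := by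
  have hs := Det.sum Finset.univ fun j _ => Det.maskSub hr hb j
  have hs' := Det.sum Finset.univ fun j _ => Det.maskSub hr' hb' j
  simp only [mulResult, restrictShares, hi, if_true]
  refine (((hc i).add (hs.mul (hb' i))).add (hs'.mul (hb i))).add ?_
  by_cases h : i = 0
  · simp only [h, if_true]
    exact hs.mul hs'
  · simp only [h, if_false]
    exact Det.zero

theorem Det.mulViews {C : Finset (Fin m)} {r r' b b' c : ∀ a, Fin m → F (k a)}
    (hr : ∀ i ∈ C, Det enc k e fun a => .elt (r a i))
    (hr' : ∀ i ∈ C, Det enc k e fun a => .elt (r' a i))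
    (hb : ∀ i, Det enc k e fun a => .elt (b a i)) (hb' : ∀ i, Det enc k e fun a => .elt (b' a i))
    (hc : ∀ i, Det enc k e fun a => .elt (c a i)) {i : Fin m} (hi : i ∈ C) :
    Det enc k e fun a => .ofList ((mulResult C (r a) (r' a) (b a) (b' a) (c a)).2 i) := by
  simp only [mulResult, restrictViews, hi, if_true, List.cons_append, List.nil_append]
  exact Det.cons (hb i) (Det.cons (hb' i) (Det.cons (hc i)
    (Det.append (fun _ => length_opening _ i) (Det.opening (Det.maskSub hr hb) i)
      (Det.opening (Det.maskSub hr' hb') i))))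

theorem Det.encodeState {C : Finset (Fin m)} {r : ∀ a, Fin m → F (k a)}
    {v : ∀ a, Fin m → List (Val (F (k a)))} (hr : ∀ i ∈ C, Det enc k e fun a => .elt (r a i))
    (hv : ∀ i ∈ C, Det enc k e fun a => .ofList (v a i)) :
    Det enc k e fun a => PZS.encodeState C (r a, v a) :=
  (Det.restrictTo C hr).pair (Det.restrictTo C hv)

theorem Det.state_share {C : Finset (Fin m)}
    {p : ∀ a, (Fin m → F (k a)) × (Fin m → List (Val (F (k a))))}
    (h : Det enc k e fun a => PZS.encodeState C (p a)) {i : Fin m} (hi : i ∈ C) :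
    Det enc k e fun a => .elt ((p a).1 i) := Det.of_restrictTo h.fst hi

theorem Det.state_view {C : Finset (Fin m)}
    {p : ∀ a, (Fin m → F (k a)) × (Fin m → List (Val (F (k a))))}
    (h : Det enc k e fun a => PZS.encodeState C (p a)) {i : Fin m} (hi : i ∈ C) :
    Det enc k e fun a => .ofList ((p a).2 i) := Det.of_restrictTo h.snd hi

/-- The encoded input holds only what `C` receives, so this also shows that the simulation uses
nothing else. Hints may be long, but each is copied as a whole in a constant number of steps. -/
theorem constCost_simEmulation (C : Finset (Fin m)) (φ : Formula (Literal F m)) :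
    ConstCost enc (ι := Σ κ, LitOut φ κ) (fun a => a.1) (fun a => encodeLitOut C φ a.2)
      fun a => (simEmulation C φ a.2).map (encodeState C) := by
  induction φ with
  | lit ℓ =>
    have hget : ∀ i (hi : i ∈ ℓ.parties), i ∈ C →
        Det enc (ι := Σ κ, LitOut (.lit ℓ) κ) (fun a => a.1) (fun a => encodeLitOut C (.lit ℓ) a.2)
          fun a => .pair (.elt (a.2 ⟨i, hi⟩).1) (a.2 ⟨i, hi⟩).2 := fun i hi hC =>
      Det.of_restrictTo (C := ℓ.inside C) (w := fun (a : Σ κ, LitOut (.lit ℓ) κ) i =>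
        .pair (.elt (a.2 i).1) (a.2 i).2) Det.self (i := ⟨i, hi⟩) (Literal.mem_inside.2 hC)
    have h : Det enc (ι := Σ κ, LitOut (.lit ℓ) κ) (fun a => a.1)
        (fun a => encodeLitOut C (.lit ℓ) a.2) fun a => encodeState C
          (restrictShares C fun i => if h : i ∈ ℓ.parties then (a.2 ⟨i, h⟩).1 else 0,
          restrictViews C fun i =>
            if h : i ∈ ℓ.parties then [.elt (a.2 ⟨i, h⟩).1, (a.2 ⟨i, h⟩).2] else []) := by
      refine Det.encodeState (fun i hC => ?_) fun i hC => ?_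
      · simp only [restrictShares, hC, if_true]
        by_cases hi : i ∈ ℓ.parties
        · simp only [hi, dif_pos]
          exact (hget i hi hC).fst
        · simp only [hi, dif_neg, not_false_iff]
          exact Det.zero
      · simp only [restrictViews, hC, if_true]
        by_cases hi : i ∈ ℓ.parties
        · simp only [hi, dif_pos]
          exact Det.cons (hget i hi hC).fst (Det.cons (hget i hi hC).snd Det.nil)
        · simp only [hi, dif_neg, not_false_iff]
          exact Det.nil
    exact ConstCost.congr h fun a => (PMF.pure_map _ _).symm
  | and φ ψ ihφ ihψ =>
    have h1 := Det.comp (Det.fst (Det.self (enc := enc) (ι := Σ κ, LitOut (.and φ ψ) κ)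
      (k := fun a => a.1) (e := fun a => encodeLitOut C (.and φ ψ) a.2)))
      (ihφ.reindex fun a : Σ κ, LitOut (.and φ ψ) κ => ⟨a.1, a.2.1⟩)
    have h2 := Det.comp (Det.snd (Det.self (enc := enc) (ι := Σ κ, LitOut (.and φ ψ) κ)
      (k := fun a => a.1) (e := fun a => encodeLitOut C (.and φ ψ) a.2)))
      (ihψ.reindex fun a : Σ κ, LitOut (.and φ ψ) κ => ⟨a.1, a.2.2⟩)
    have h3 := h1.prod h2
    refine ConstCost.congr (h3.map (g := fun a q => encodeState C
      (fun i => q.1.1 i + q.2.1 i, fun i => q.1.2 i ++ q.2.2 i)) ?_) fun a => ?_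
    · refine Det.intro fun hs => ?_
      refine Det.encodeState (fun i hi => (hs.fst.state_share hi).add (hs.snd.state_share hi))
        fun i hi => ?_
      exact Det.append (fun p => length_simEmulation C φ _ (mem_support_prodLaw p.2).1 hi)
        (hs.fst.state_view hi) (hs.snd.state_view hi)
    · rw [simEmulation_and, PMF.map_comp]; rfl
  | or φ ψ ihφ ihψ =>
    have h1 := Det.comp (Det.fst (Det.self (enc := enc) (ι := Σ κ, LitOut (.or φ ψ) κ)
      (k := fun a => a.1) (e := fun a => encodeLitOut C (.or φ ψ) a.2)))
      (ihφ.reindex fun a : Σ κ, LitOut (.or φ ψ) κ => ⟨a.1, a.2.1⟩)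
    have h2 := Det.comp (Det.snd (Det.self (enc := enc) (ι := Σ κ, LitOut (.or φ ψ) κ)
      (k := fun a => a.1) (e := fun a => encodeLitOut C (.or φ ψ) a.2)))
      (ihψ.reindex fun a : Σ κ, LitOut (.or φ ψ) κ => ⟨a.1, a.2.2⟩)
    have hu := ConstCost.uniform_shares (enc := enc) (ι := Σ κ, LitOut (.or φ ψ) κ)
      (k := fun a => a.1) (e := fun a => encodeLitOut C (.or φ ψ) a.2) (P := Fin m)
    have h3 := (h1.prod h2).prod (hu.prod (hu.prod hu))
    refine ConstCost.congr (h3.map (g := fun a q => encodeState C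
      ((mulResult C q.1.1.1 q.1.2.1 q.2.1 q.2.2.1 q.2.2.2).1, fun i =>
          q.1.1.2 i ++ q.1.2.2 i ++
            (mulResult C q.1.1.1 q.1.2.1 q.2.1 q.2.2.1 q.2.2.2).2 i)) ?_) fun a => ?_
    · refine Det.intro fun hs => ?_
      refine Det.encodeState (fun i hi => ?_) fun i hi => ?_
      · exact Det.mulShares (fun i hi => hs.fst.fst.state_share hi)
          (fun i hi => hs.fst.snd.state_share hi) (fun i => hs.snd.fst.of_sharesVal i)
          (fun i => hs.snd.snd.fst.of_sharesVal i) (fun i => hs.snd.snd.snd.of_sharesVal i) hi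
      · refine Det.append (n := emulationLength i φ + emulationLength i ψ) (fun p => ?_)
          (Det.append (fun p => length_simEmulation C φ _
            (mem_support_prodLaw (mem_support_prodLaw p.2).1).1 hi)
            (hs.fst.fst.state_view hi) (hs.fst.snd.state_view hi)) ?_
        · have h := mem_support_prodLaw (mem_support_prodLaw p.2).1
          rw [List.length_append, length_simEmulation C φ _ h.1 hi,
            length_simEmulation C ψ _ h.2 hi]
        · exact Det.mulViews (fun i hi => hs.fst.fst.state_share hi)
            (fun i hi => hs.fst.snd.state_share hi) (fun i => hs.snd.fst.of_sharesVal i)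
            (fun i => hs.snd.snd.fst.of_sharesVal i) (fun i => hs.snd.snd.snd.of_sharesVal i) hi
    · rw [simEmulation_or, PMF.map_comp]; rfl

/-- The inputs and the shares of the parties in `C`. -/
def encodeInputs {K : Type} (C : Finset (Fin m)) (x : Fin m → Input) (s : Fin m → K) : Val K :=
  restrictTo C fun i => .pair (.ofBits (x i)) (.elt (s i))

theorem simView_eq (C : Finset (Fin m)) {κ : ℕ} (x : Fin m → Input) (φ : Formula (Literal F m))
    (o : LitOut φ κ) (s : Fin m → F κ) : simView C x φ o s =
      (prodLaw (simEmulation C φ o) (prodLaw (PMF.uniformOfFintype (Fin m → F κ))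
        (PMF.uniformOfFintype (Fin m → F κ)))).map fun q => restrictViews C fun i =>
          Val.ofBits (x i) :: (q.1.2 i ++ transView C q.1.1 s q.2.1 q.2.2 i) := by
  simp only [simView, simTrans, ← PMF.bind_pure_comp, prodLaw_bind, PMF.bind_bind,
    PMF.pure_bind, Function.comp_def]

theorem constCost_simView (C : Finset (Fin m)) (φ : Formula (Literal F m)) :
    ConstCost enc (ι := Σ κ, LitOut φ κ × (Fin m → Input) × (Fin m → F κ)) (fun a => a.1)
      (fun a => .pair (encodeLitOut C φ a.2.1) (encodeInputs C a.2.2.1 a.2.2.2))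
      fun a => (simView C a.2.2.1 φ a.2.1 a.2.2.2).map fun v =>
        restrictTo C fun i => .ofList (v i) := by
  have h0 := Det.self (enc := enc)
    (ι := Σ κ, LitOut φ κ × (Fin m → Input) × (Fin m → F κ)) (k := fun a => a.1)
    (e := fun a => .pair (encodeLitOut C φ a.2.1) (encodeInputs C a.2.2.1 a.2.2.2))
  have h1 := Det.comp h0.fst ((constCost_simEmulation C φ).reindex
    fun a : Σ κ, LitOut φ κ × (Fin m → Input) × (Fin m → F κ) => ⟨a.1, a.2.1⟩)
  have hu := ConstCost.uniform_shares (enc := enc)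
    (ι := Σ κ, LitOut φ κ × (Fin m → Input) × (Fin m → F κ)) (k := fun a => a.1)
    (e := fun a => .pair (encodeLitOut C φ a.2.1) (encodeInputs C a.2.2.1 a.2.2.2)) (P := Fin m)
  -- The inputs and output shares are carried through the random step as the encoding of a trivial
  -- sample.
  have hi : ConstCost enc (ι := Σ κ, LitOut φ κ × (Fin m → Input) × (Fin m → F κ)) (fun a => a.1)
      (fun a => .pair (encodeLitOut C φ a.2.1) (encodeInputs C a.2.2.1 a.2.2.2))
      fun a => (PMF.pure ()).map fun _ => encodeInputs C a.2.2.1 a.2.2.2 :=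
    ConstCost.congr h0.snd fun a =>
      (PMF.pure_map (fun _ => encodeInputs C a.2.2.1 a.2.2.2) ()).symm
  have h3 := hi.prod (h1.prod (hu.prod hu))
  refine ConstCost.congr (h3.map (g := fun a q => restrictTo C fun i => .ofList
    (restrictViews C (fun i => Val.ofBits (a.2.2.1 i) ::
      (q.2.1.2 i ++ transView C q.2.1.1 a.2.2.2 q.2.2.1 q.2.2.2 i)) i)) ?_) fun a => ?_
  · refine Det.intro fun hs => ?_
    refine Det.restrictTo C fun i hi => ?_
    simp only [restrictViews, transView, hi, if_true, List.cons_append, List.nil_append]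
    have ha := fun i => hs.snd.snd.fst.of_sharesVal i
    have hb := fun i => hs.snd.snd.snd.of_sharesVal i
    have hw := Det.maskAdd (fun i hi => hs.snd.fst.state_share hi) ha
    refine Det.cons (Det.of_restrictTo hs.fst hi).fst (Det.append (fun p => length_simEmulation C φ
      _ (mem_support_prodLaw (mem_support_prodLaw p.2).2).1 hi) (hs.snd.fst.state_view hi) ?_)
    exact Det.cons (ha i) (Det.cons (hb i) (Det.cons (((Det.sum _ fun j _ => hw j).mul (hb i)).sub
      (Det.of_restrictTo hs.fst hi).snd) (Det.opening hw i)))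
  · rw [simView_eq, PMF.map_comp, prodLaw_map, PMF.pure_bind]; rfl

end ViewProgram

/-! ### Computational indistinguishability -/

section Indistinguishability

theorem Negligible.add {μ ν : ℕ → ℝ} (hμ : Negligible μ) (hν : Negligible ν) :
    Negligible fun κ => μ κ + ν κ := Asymptotics.SuperpolynomialDecay.add hμ hν

theorem Negligible.const_mul {μ : ℕ → ℝ} (hμ : Negligible μ) (c : ℝ) :
    Negligible fun κ => c * μ κ := Asymptotics.SuperpolynomialDecay.const_mul hμ c

theorem negligible_zero : Negligible fun _ => 0 :=
  Asymptotics.superpolynomialDecay_zero _ _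

variable {P : Type} [Fintype P] {F : ℕ → Type} [∀ κ, Field (F κ)] [∀ κ, Fintype (F κ)]
  {enc : ∀ κ, F κ ↪ List Bool} {X Y Z : (κ : ℕ) → (P → Input) → PMF (Val (F κ))}

theorem accept_map {K : Type} [Field K] [Fintype K] (enc : K ↪ List Bool) (D : Prog)
    (X : PMF (Val K)) (f : Val K → Val K) :
    D.accept enc (X.map f) = ((X.bind fun v => D.run enc (f v)) Val.tt).toReal := by
  rw [Prog.accept, PMF.bind_map]; rfl

/-- Statistically close ensembles are computationally indistinguishable. -/
theorem CompIndist.of_statistical (h : ∀ L : Polynomial ℕ, ∃ μ : ℕ → ℝ, Negligible μ ∧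
    ∀ κ x, inputSize Finset.univ x ≤ L.eval κ → ∀ (f : Val (F κ) → PMF (Val (F κ))) (b : Val (F κ)),
      |((X κ x).bind f b).toReal - ((Y κ x).bind f b).toReal| ≤ μ κ) : CompIndist enc X Y := by
  intro D T L
  obtain ⟨μ, hμ, h⟩ := h L
  refine ⟨μ, hμ, fun κ x hx z _ => ?_⟩
  rw [accept_map, accept_map]
  exact h κ x hx _ _

theorem CompIndist.refl (X : (κ : ℕ) → (P → Input) → PMF (Val (F κ))) : CompIndist enc X X :=
  CompIndist.of_statistical fun _ => ⟨fun _ => 0, negligible_zero, fun κ x _ f b => by simp⟩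

theorem CompIndist.trans (h : CompIndist enc X Y) (h' : CompIndist enc Y Z) :
    CompIndist enc X Z := by
  intro D T L
  obtain ⟨μ, hμ, h⟩ := h D T L
  obtain ⟨ν, hν, h'⟩ := h' D T L
  exact ⟨_, hμ.add hν, fun κ x hx z hz =>
    (abs_sub_le _ _ _).trans (add_le_add (h κ x hx z hz) (h' κ x hx z hz))⟩

theorem CompIndist.congr {X' Y' : (κ : ℕ) → (P → Input) → PMF (Val (F κ))}
    (h : CompIndist enc X Y) (hX : ∀ κ x, X κ x = X' κ x) (hY : ∀ κ x, Y κ x = Y' κ x) :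
    CompIndist enc X' Y' := by
  have h1 : X = X' := funext fun κ => funext (hX κ)
  have h2 : Y = Y' := funext fun κ => funext (hY κ)
  rwa [← h1, ← h2]

/-- Parties that are not involved do not matter. -/
theorem CompIndist.extend {P' : Type} [Fintype P'] (r : P → P')
    (h : CompIndist enc X Y)
    (hr : ∀ x : P' → Input, inputSize Finset.univ (fun i => x (r i)) ≤ inputSize Finset.univ x) :
    CompIndist enc (fun κ (x : P' → Input) => X κ fun i => x (r i))
      fun κ (x : P' → Input) => Y κ fun i => x (r i) := by
  intro D T L
  obtain ⟨μ, hμ, h⟩ := h D T L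
  exact ⟨μ, hμ, fun κ x hx z hz => h κ _ ((hr x).trans hx) z hz⟩

/-- Indistinguishability is preserved by efficient processing that may use further data with an
arbitrary independent law: the best choice of these data can be given as an advice. -/
theorem CompIndist.process (h : CompIndist enc X Y)
    (W : (κ : ℕ) → (P → Input) → PMF (Val (F κ)))
    {f : ∀ κ, Val (F κ) → Val (F κ) → PMF (Val (F κ))}
    (hf : ConstCost enc (ι := Σ κ, Val (F κ) × Val (F κ)) (fun a => a.1)
      (fun a => .pair a.2.1 a.2.2) fun a => f a.1 a.2.1 a.2.2) :
    CompIndist enc (fun κ x => (W κ x).bind fun w => (X κ x).bind fun v => f κ w v)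
      fun κ x => (W κ x).bind fun w => (Y κ x).bind fun v => f κ w v := by
  -- The reduction: the advice `(z, w)` and the sample `v` are turned into the advice `z` and a
  -- sample of `f κ w v`, on which `D` is run.
  have hA : ConstCost enc (ι := Σ κ, Val (F κ) × Val (F κ) × Val (F κ)) (fun a => a.1)
      (fun a => .pair (.unary a.1) (.pair (.pair a.2.1 a.2.2.1) a.2.2.2)) fun a =>
        (f a.1 a.2.2.1 a.2.2.2).map fun r => .pair (.unary a.1) (.pair a.2.1 r) := by
    have h0 := Det.self (enc := enc) (ι := Σ κ, Val (F κ) × Val (F κ) × Val (F κ))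
      (k := fun a => a.1)
      (e := fun a => .pair (.unary a.1) (.pair (.pair a.2.1 a.2.2.1) a.2.2.2))
    have h1 := Det.comp (h0.snd.fst.snd.pair h0.snd.snd) (hf.reindex
      fun a : Σ κ, Val (F κ) × Val (F κ) × Val (F κ) => ⟨a.1, a.2.2.1, a.2.2.2⟩)
    refine (ConstCost.pair h0.fst (ConstCost.pair h0.snd.fst.fst h1)).congr fun a => ?_
    simp only [PMF.pure_bind, PMF.map_comp]
    rfl
  obtain ⟨A, c, hc, hA⟩ := hA
  intro D T L
  obtain ⟨μ, hμ, h⟩ := h (.seq A D) (Polynomial.C c + T + 1) L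
  refine ⟨μ, hμ, fun κ x hx z hz => ?_⟩
  rw [accept_map, accept_map, PMF.bind_bind, PMF.bind_bind]
  -- The bound is uniform over advice, so it holds for each `w` and hence on average; `w` never has
  -- to be sampled.
  refine abs_bind_sub_le _ _ _ _ fun w => ?_
  have hrun : ∀ v, (Prog.seq A D).run (enc κ) (.pair (.unary κ) (.pair (.pair z w) v)) =
      (f κ w v).bind fun r => D.run (enc κ) (.pair (.unary κ) (.pair z r)) := fun v => by
    rw [run_seq, hA ⟨κ, z, w, v⟩, PMF.bind_map]; rfl
  have := h κ x hx (.pair z w) fun v => by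
    rw [Polynomial.eval_add, Polynomial.eval_add, Polynomial.eval_one, Polynomial.eval_C]
    refine costLE_seq (hc _ _) fun u hu => ?_
    rw [hA ⟨κ, z, w, v⟩, PMF.mem_support_map_iff] at hu
    obtain ⟨r, _, rfl⟩ := hu
    exact hz r
  simp only [accept_map, hrun] at this
  simpa only [PMF.bind_bind] using this

/-- One component is replaced at a time, while the other serves as the independent datum in
`CompIndist.process`. -/
theorem CompIndist.pair {X' Y' : (κ : ℕ) → (P → Input) → PMF (Val (F κ))}
    (h : CompIndist enc X Y) (h' : CompIndist enc X' Y') :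
    CompIndist enc (fun κ x => (X κ x).bind fun v => (X' κ x).map fun v' => .pair v v')
      fun κ x => (Y κ x).bind fun v => (Y' κ x).map fun v' => .pair v v' := by
  have h0 := Det.self (enc := enc) (ι := Σ κ, Val (F κ) × Val (F κ)) (k := fun a => a.1)
      (e := fun a => .pair a.2.1 a.2.2)
  refine CompIndist.trans (Y := fun κ x => (Y κ x).bind fun v => (X' κ x).map fun v' => .pair v v')
    ((h.process X' (f := fun _ w v => PMF.pure (.pair v w)) (h0.snd.pair h0.fst)).congr ?_ ?_)
    (h'.process Y (f := fun _ w v => PMF.pure (.pair w v)) h0)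
  · exact fun κ x => PMF.bind_comm _ _ _
  · exact fun κ x => PMF.bind_comm _ _ _

end Indistinguishability

/-! ### Security -/

section Simulator

variable {m : ℕ} [NeZero m] {F : ℕ → Type} [∀ κ, Field (F κ)] [∀ κ, Fintype (F κ)]
  {enc : ∀ κ, F κ ↪ List Bool}

theorem inputSize_inside_le (ℓ : Literal F m) (C : Finset (Fin m)) (x : Fin m → Input) :
    inputSize (ℓ.inside C) (fun i => x i) ≤ inputSize C x := by
  unfold inputSize Literal.inside
  rw [Finset.sum_subtype_eq_sum_filter (f := fun i => (x i).length)]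
  exact Finset.sum_le_sum_of_subset (Finset.filter_subset _ _)

theorem Literal.inside_univ (ℓ : Literal F m) : ℓ.inside Finset.univ = Finset.univ := by
  ext i; simp [Literal.mem_inside]

/-- A call can be simulated for the parties in `C`, given their inputs and arbitrary shares. -/
theorem exists_sim_literal {ℓ : Literal F m} (hℓ : IsRelaxedPZS enc ℓ.pred ℓ.func)
    (C : Finset (Fin m)) : ∃ X : (κ : ℕ) → (Fin m → Input) → PMF (Val (F κ)),
      PolyCost enc (ι := Σ κ, (Fin m → Input) × (Fin m → F κ)) (fun a => a.1)
        (fun a => simInput a.1 C a.2.1 a.2.2) (fun a => a.1 + inputSize C a.2.1)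
        (fun a => X a.1 a.2.1) ∧
      CompIndist enc X fun κ x => (litLaw κ x (.lit ℓ)).map (encodeLitOut C (.lit ℓ)) := by
  have h0 := Det.self (enc := enc) (ι := Σ κ, (Fin m → Input) × (Fin m → F κ))
    (k := fun a => a.1) (e := fun a => simInput a.1 C a.2.1 a.2.2)
  have hbits : ∀ i ∈ C, Det enc (ι := Σ κ, (Fin m → Input) × (Fin m → F κ)) (fun a => a.1)
      (fun a => simInput a.1 C a.2.1 a.2.2) fun a => .ofBits (a.2.1 i) := fun i hi =>
    (Det.of_restrictTo h0.snd hi).fst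
  have hsize : ∀ x : Fin m → Input,
      inputSize Finset.univ (fun i : ℓ.parties => x i) ≤ inputSize Finset.univ x := fun x => by
    simpa only [Literal.inside_univ] using inputSize_inside_le ℓ Finset.univ x
  by_cases hC : ℓ.inside C = Finset.univ
  -- All parties of the literal are corrupted. Privacy says nothing here, but all inputs are known
  -- and the functionality itself can be run.
  · refine ⟨fun κ x => (litLaw κ x (.lit ℓ)).map (encodeLitOut C (.lit ℓ)), ?_, CompIndist.refl _⟩
    obtain ⟨g, T, hg⟩ := hℓ.polyTime
    have hin : Det enc (ι := Σ κ, (Fin m → Input) × (Fin m → F κ)) (fun a => a.1)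
        (fun a => simInput a.1 C a.2.1 a.2.2)
        fun a => .pair (.unary a.1) (restrictTo Finset.univ fun i : ℓ.parties =>
          .ofBits (a.2.1 i)) :=
      h0.fst.pair (Det.restrictTo _ fun i _ =>
        hbits i (Literal.mem_inside.1 (hC ▸ Finset.mem_univ i)))
    refine hin.comp_polyCost (PolyCost.mono
      (n := fun a => a.1 + inputSize Finset.univ fun i : ℓ.parties => a.2.1 i)
      ⟨g, T, fun a => ⟨(hg a.1 _).1, ?_⟩⟩ fun a => ?_)
    · rw [(hg a.1 _).2]
      simp only [litLaw, encodeLitOut, hC]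
      rfl
    · rw [← hC]
      exact Nat.add_le_add_left (inputSize_inside_le ℓ C _) _
  -- The literal's simulator gets uniform shares. A proper subset cannot tell them from ideal ones,
  -- so the truth value of the literal is not needed.
  · obtain ⟨S, ⟨T, hT⟩, hS⟩ := hℓ.priv
    refine ⟨fun κ x => (PMF.uniformOfFintype (ℓ.parties → F κ)).bind fun s =>
      S.run (enc κ) (simInput κ (ℓ.inside C) (fun i => x i) s), ?_, ?_⟩
    · have hu := (ConstCost.congr h0 fun a =>
        (PMF.pure_map (fun _ => simInput a.1 C a.2.1 a.2.2) ()).symm).prod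
          (ConstCost.uniform_shares (enc := enc) (ι := Σ κ, (Fin m → Input) × (Fin m → F κ))
          (k := fun a => a.1) (e := fun a => simInput a.1 C a.2.1 a.2.2) (P := ℓ.parties))
      have hin : ConstCost enc (ι := Σ κ, (Fin m → Input) × (Fin m → F κ)) (fun a => a.1)
          (fun a => simInput a.1 C a.2.1 a.2.2) fun a =>
          (PMF.uniformOfFintype (ℓ.parties → F a.1)).map fun s =>
            simInput a.1 (ℓ.inside C) (fun i => a.2.1 i) s := by
        refine ConstCost.congr (hu.map (g := fun a p =>
          simInput a.1 (ℓ.inside C) (fun i => a.2.1 i) p.2) (Det.intro fun hs => ?_)) fun a => ?_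
        · exact hs.fst.fst.pair (Det.restrictTo _ fun i hi =>
            (Det.of_restrictTo hs.fst.snd (Literal.mem_inside.1 hi)).fst.pair
              (hs.snd.of_sharesVal i))
        · rw [prodLaw_map, PMF.pure_bind]; rfl
      refine PolyCost.andThen hin.polyCost (PolyCost.mono
        (n := fun p => p.1.1.1 + inputSize (ℓ.inside C) fun i => p.1.1.2.1 i)
        ⟨S, T, fun p => ⟨hT _ _ _ _, rfl⟩⟩ fun p => ?_)
      exact Nat.add_le_add_left (inputSize_inside_le ℓ C _) _
    · refine ((hS _ hC).extend (fun i : ℓ.parties => (i : Fin m)) hsize).congr (fun κ x => ?_)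
        fun κ x => rfl
      refine idealPZS_bind_congr _ _ hC _ fun s s' hs => ?_
      -- The simulator's input contains the shares of `C` only, as `idealPZS_bind_congr` requires.
      have : simInput κ (ℓ.inside C) (fun i => x i) s =
          simInput κ (ℓ.inside C) (fun i => x i) s' := by
        simp only [simInput, restrictTo]
        congr 3
        funext i
        by_cases hi : i ∈ ℓ.inside C <;> simp [hi, hs]
      rw [this]

/-- All calls of a formula can be simulated for the parties in `C`. -/
theorem exists_sim_formula {φ : Formula (Literal F m)}
    (hφ : ∀ ℓ ∈ φ.literals, IsRelaxedPZS enc ℓ.pred ℓ.func) (C : Finset (Fin m)) :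
    ∃ X : (κ : ℕ) → (Fin m → Input) → PMF (Val (F κ)),
      PolyCost enc (ι := Σ κ, (Fin m → Input) × (Fin m → F κ)) (fun a => a.1)
        (fun a => simInput a.1 C a.2.1 a.2.2) (fun a => a.1 + inputSize C a.2.1)
        (fun a => X a.1 a.2.1) ∧
      CompIndist enc X fun κ x => (litLaw κ x φ).map (encodeLitOut C φ) := by
  induction φ with
  | lit ℓ => exact exists_sim_literal (hφ ℓ (by simp [Formula.literals])) C
  | and φ ψ ihφ ihψ =>
    obtain ⟨X, hX, hX'⟩ := ihφ fun ℓ h => hφ ℓ (List.mem_append_left _ h)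
    obtain ⟨Y, hY, hY'⟩ := ihψ fun ℓ h => hφ ℓ (List.mem_append_right _ h)
    refine ⟨_, hX.pair hY, (hX'.pair hY').congr (fun κ x => rfl) fun κ x => ?_⟩
    rw [← PMF.bind_pure_comp (encodeLitOut C (.and φ ψ)), litLaw_and_bind]
    simp only [PMF.map_comp, PMF.bind_map]
    rfl
  | or φ ψ ihφ ihψ =>
    obtain ⟨X, hX, hX'⟩ := ihφ fun ℓ h => hφ ℓ (List.mem_append_left _ h)
    obtain ⟨Y, hY, hY'⟩ := ihψ fun ℓ h => hφ ℓ (List.mem_append_right _ h)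
    refine ⟨_, hX.pair hY, (hX'.pair hY').congr (fun κ x => rfl) fun κ x => ?_⟩
    rw [← PMF.bind_pure_comp (encodeLitOut C (.or φ ψ)), litLaw_or_bind]
    simp only [PMF.map_comp, PMF.bind_map]
    rfl

theorem exists_negligible_error {φ : Formula (Literal F m)}
    (hφ : ∀ ℓ ∈ φ.literals, IsRelaxedPZS enc ℓ.pred ℓ.func) (L : Polynomial ℕ) :
    ∃ μ : ℕ → ℝ, Negligible μ ∧ ∀ κ (x : Fin m → Input),
      inputSize Finset.univ x ≤ L.eval κ → (φ.literals.map fun ℓ => ℓ.error κ x).sum ≤ μ κ := by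
  generalize φ.literals = l at hφ
  induction l with
  | nil => exact ⟨fun _ => 0, negligible_zero, fun κ x _ => by simp⟩
  | cons ℓ l ih =>
    obtain ⟨μ, hμ, h⟩ := ih fun ℓ' h => hφ ℓ' (List.mem_cons_of_mem ℓ h)
    obtain ⟨ν, hν, h'⟩ := (hφ ℓ List.mem_cons_self).correct L
    refine ⟨_, hν.add hμ, fun κ x hx => ?_⟩
    rw [List.map_cons, List.sum_cons]
    refine add_le_add (h' κ _ (le_trans ?_ hx)) (h κ x hx)
    simpa only [Literal.inside_univ] using inputSize_inside_le ℓ Finset.univ x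

/-- One term `2⁻¹ ^ σ κ` pays for the `∨` gates, the other for an accidental zero of a uniform
secret. -/
theorem secret_wrong_le_error {φ : Formula (Literal F m)} {σ : ℕ → ℕ}
    (hF : ∀ κ, 2 ^ σ κ ≤ Fintype.card (F κ))
    (hOr : ∀ κ, φ.numOr * 2 ^ σ κ ≤ Fintype.card (F κ)) (κ : ℕ) (x : Fin m → Input) :
    (((litLaw κ x φ).map fun o => ¬(secret φ o = 0 ↔ φ.pred x)) True).toReal ≤
      (φ.literals.map fun ℓ => ℓ.error κ x).sum + 2 * (2 : ℝ)⁻¹ ^ σ κ := by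
  have h1 := secret_wrong_le κ x φ
  have h2 := tvDist_secret κ x φ
  have h3 := mul_inv_card_le Fintype.card_pos (hOr κ)
  have h4 := mul_inv_card_le (n := 1) Fintype.card_pos (by simpa using hF κ)
  rw [Nat.cast_one, one_mul] at h4
  linarith

theorem restrictTo_restrictViews {K : Type} (C : Finset (Fin m)) (v : Fin m → List (Val K)) :
    restrictTo C (fun i => .ofList (restrictViews C v i)) = restrictTo C fun i => .ofList (v i) := by
  simp only [restrictTo]
  congr 2
  funext i
  by_cases hi : i ∈ C <;> simp [restrictViews, hi]

theorem protocol_view_law {C : Finset (Fin m)} (hC : C ≠ Finset.univ) (κ : ℕ)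
    (x : Fin m → Input) (φ : Formula (Literal F m)) :
    ((protocol φ κ x).map fun o =>
        .pair (restrictTo C fun i => .ofList (o.1 i)) (sharesVal o.2)) =
      (litLaw κ x φ).bind fun o => (idealPZS (secret φ o = 0)).bind fun s =>
        (simView C x φ o s).map fun v =>
          Val.pair (restrictTo C fun i => .ofList (v i)) (sharesVal s) := by
  have h := congrArg (PMF.map fun p =>
    Val.pair (restrictTo C fun i => .ofList (p.2 i)) (sharesVal p.1)) (protocol_map hC κ x φ)
  simpa only [PMF.map_comp, PMF.map_bind, Function.comp_def, restrictTo_restrictViews] using h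

/-- The real views and outputs are statistically close to those where the outputs are ideal shares
for the compound predicate and the views are simulated from the real outputs of the
functionalities. -/
theorem protocol_compIndist_hybrid {C : Finset (Fin m)} (hC : C ≠ Finset.univ)
    {φ : Formula (Literal F m)} (hφ : ∀ ℓ ∈ φ.literals, IsRelaxedPZS enc ℓ.pred ℓ.func)
    {σ : ℕ → ℕ} (hσ : Negligible fun κ => (2 : ℝ)⁻¹ ^ σ κ)
    (hF : ∀ κ, 2 ^ σ κ ≤ Fintype.card (F κ))
    (hOr : ∀ κ, φ.numOr * 2 ^ σ κ ≤ Fintype.card (F κ)) :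
    CompIndist enc
      (fun κ x => (idealPZS (φ.pred x)).bind fun s => (litLaw κ x φ).bind fun o =>
        (simView C x φ o s).map fun v =>
          Val.pair (restrictTo C fun i => .ofList (v i)) (sharesVal s))
      fun κ x => (protocol φ κ x).map fun o =>
        .pair (restrictTo C fun i => .ofList (o.1 i)) (sharesVal o.2) := by
  refine CompIndist.of_statistical fun L => ?_
  obtain ⟨μ, hμ, h⟩ := exists_negligible_error hφ L
  refine ⟨_, hμ.add (hσ.const_mul 2), fun κ x hx f b => ?_⟩
  rw [protocol_view_law hC, PMF.bind_comm, PMF.bind_bind, PMF.bind_bind]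
  -- Given the outputs `o`, the two laws differ only in the predicate passed to `idealPZS`, and they
  -- coincide unless the secret indicates the wrong truth value.
  refine (abs_bind_sub_le_event _ _ _ _ _ fun o ho => ?_).trans
    ((secret_wrong_le_error hF hOr κ x).trans (add_le_add (h κ x hx) le_rfl))
  rw [not_not] at ho
  simp only [ho]

/-- The simulator. -/
theorem exists_simulator {φ : Formula (Literal F m)}
    (hφ : ∀ ℓ ∈ φ.literals, IsRelaxedPZS enc ℓ.pred ℓ.func) :
    ∃ Sim : Prog, PolyTimeSim (P := Fin m) enc Sim ∧ ∀ C : Finset (Fin m),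
      CompIndist enc
        (fun κ x => (idealPZS (φ.pred x)).bind fun s =>
          (Sim.run (enc κ) (simInput κ C x s)).map fun w => .pair w (sharesVal s))
        fun κ x => (idealPZS (φ.pred x)).bind fun s => (litLaw κ x φ).bind fun o =>
          (simView C x φ o s).map fun v =>
            Val.pair (restrictTo C fun i => .ofList (v i)) (sharesVal s) := by
  -- For each corrupted set, `X C` imitates what the calls deliver and `A C` assembles the view from
  -- it.
  choose X hX hX' using exists_sim_formula hφ
  choose A c hc hA using fun C => constCost_simView (enc := enc) C φ
  have hfix : ∀ C : Finset (Fin m), PolyCost enc (ι := Σ κ, (Fin m → Input) × (Fin m → F κ))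
      (fun a => a.1) (fun a => simInput a.1 C a.2.1 a.2.2) (fun a => a.1 + inputSize C a.2.1)
      fun a => (X C a.1 a.2.1).bind fun v =>
        (A C).run (enc a.1) (.pair v (encodeInputs C a.2.1 a.2.2)) := fun C => by
    have h0 := Det.self (enc := enc) (ι := Σ κ, (Fin m → Input) × (Fin m → F κ))
      (k := fun a => a.1) (e := fun a => simInput a.1 C a.2.1 a.2.2)
    have h1 := (hX C).pair h0.snd.polyCost
    refine PolyCost.andThen (β := fun a : Σ κ, (Fin m → Input) × (Fin m → F κ) => Val (F a.1))
      (e' := fun (a : Σ κ, (Fin m → Input) × (Fin m → F κ)) v => .pair v (encodeInputs C a.2.1 a.2.2)) (h1.congr fun a => ?_)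
      (ConstCost.polyCost ⟨A C, c C, hc C, fun _ => rfl⟩)
    simp only [PMF.pure_map]
    rfl
  -- One program for all corrupted sets: the set shows in the blank entries of the input and selects
  -- one of finitely many programs.
  have hall : PolyCost enc (ι := Σ κ, Finset (Fin m) × (Fin m → Input) × (Fin m → F κ))
      (fun a => a.1) (fun a => simInput a.1 a.2.1 a.2.2.1 a.2.2.2)
      (fun a => a.1 + inputSize a.2.1 a.2.2.1)
      fun a => (X a.2.1 a.1 a.2.2.1).bind fun v =>
        (A a.2.1).run (enc a.1) (.pair v (encodeInputs a.2.1 a.2.2.1 a.2.2.2)) := by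
    have hentry := fun i => Det.entry (Det.snd (Det.self (enc := enc)
      (ι := Σ κ, Finset (Fin m) × (Fin m → Input) × (Fin m → F κ)) (k := fun a => a.1)
      (e := fun a => simInput a.1 a.2.1 a.2.2.1 a.2.2.2))) i
    refine PolyCost.cases_finset (C := fun a : Σ κ, Finset (Fin m) × (Fin m → Input) × (Fin m → F κ) =>
      a.2.1) (fun i => ⟨_, hentry i, fun a => ?_⟩) fun D => ?_
    · by_cases hi : i ∈ a.2.1 <;> simp [hi, Val.ofOption]
    · obtain ⟨p, T, h⟩ := hfix D
      refine ⟨p, T, ?_⟩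
      rintro ⟨⟨κ, C, x, s⟩, rfl⟩
      exact h ⟨κ, x, s⟩
  obtain ⟨Sim, T, h⟩ := hall
  refine ⟨Sim, ⟨T, fun κ C x s => (h ⟨κ, C, x, s⟩).1⟩, fun C => ?_⟩
  -- The inputs and the ideal shares, independent of the calls, form the auxiliary datum; assembling
  -- the view is the efficient processing.
  have hf : ConstCost enc (ι := Σ κ, Val (F κ) × Val (F κ)) (fun a => a.1)
      (fun a => .pair a.2.1 a.2.2) fun a =>
        ((A C).run (enc a.1) (.pair a.2.2 a.2.1.head)).map fun r => .pair r a.2.1.tail := by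
    have h0 := Det.self (enc := enc) (ι := Σ κ, Val (F κ) × Val (F κ)) (k := fun a => a.1)
      (e := fun a => .pair a.2.1 a.2.2)
    refine ConstCost.congr (ConstCost.pair (Det.comp (h0.snd.pair h0.fst.head)
      ⟨A C, c C, hc C, fun _ => rfl⟩) h0.fst.tail) fun a => ?_
    simp only [PMF.pure_map]
    rfl
  refine ((hX' C).process (fun κ x => (idealPZS (φ.pred x)).map fun s =>
    .pair (encodeInputs C x s) (sharesVal s)) (f := fun κ w v =>
      ((A C).run (enc κ) (.pair v w.head)).map fun r => .pair r w.tail) hf).congr (fun κ x => ?_) fun κ x => ?_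
  · rw [PMF.bind_map]
    refine congrArg _ (funext fun s => ?_)
    rw [(h ⟨κ, C, x, s⟩).2, PMF.map_bind]
    rfl
  · simp only [PMF.bind_map]
    refine congrArg _ (funext fun s => congrArg (PMF.bind _) (funext fun o => ?_))
    have h2 := hA C ⟨κ, o, x, s⟩
    dsimp only at h2
    simp only [Function.comp, Val.head, Val.tail, h2, PMF.map_comp]
    rfl

end Simulator

end PZS

/-! ### The main theorem -/

open PZS in
theorem mainTheorem4 {m : ℕ} [NeZero m] (hm : 2 ≤ m)
    (F : ℕ → Type) [∀ κ, Field (F κ)] [∀ κ, Fintype (F κ)] (enc : ∀ κ, F κ ↪ List Bool)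
    (φ : Formula (Literal F m))
    (hφ : ∀ ℓ ∈ φ.literals, IsRelaxedPZS enc ℓ.pred ℓ.func)
    (σ : ℕ → ℕ) (hσ : Negligible fun κ => (2 : ℝ)⁻¹ ^ σ κ)
    (hF : ∀ κ, 2 ^ σ κ ≤ Fintype.card (F κ))
    (hOr : ∀ κ, φ.numOr * 2 ^ σ κ ≤ Fintype.card (F κ)) :
    SecurelyRealizesPZS enc φ.pred (protocol φ) ∧
      ∀ κ (x : Fin m → Input),
        tvDist ((emulation κ x φ).map fun o => ∑ i, o.1 i) (idealSecret (φ.pred x)) ≤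
            (φ.literals.map fun ℓ => ℓ.error κ x).sum + (2 : ℝ)⁻¹ ^ σ κ ∧
          tvDist ((protocol φ κ x).map fun o => o.2) (idealPZS (φ.pred x)) ≤
            (φ.literals.map fun ℓ => ℓ.error κ x).sum + 2 * (2 : ℝ)⁻¹ ^ σ κ := by
  refine ⟨?_, fun κ x => ?_⟩
  · obtain ⟨Sim, hSim, h⟩ := exists_simulator hφ
    -- The computational step replaces the simulated calls by real ones; the statistical step then
    -- passes to the real outputs.
    exact ⟨Sim, hSim, fun C hC => (h C).trans (protocol_compIndist_hybrid hC hφ hσ hF hOr)⟩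
  · have h1 := tvDist_secret κ x φ
    have h2 := tvDist_output κ x φ
    have h3 := mul_inv_card_le Fintype.card_pos (hOr κ)
    have h4 := mul_inv_card_le (n := 1) Fintype.card_pos (by simpa using hF κ)
    rw [Nat.cast_one, one_mul] at h4
    rw [emulation_map_sum]
    constructor <;> linarith
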